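/- For $n\ge 1$ let $\mathrm{O}(n,1)$ be the group of linear automorphisms of $\mathbb{R}^{n+1}$ preserving the form $\langle x,y\rangle = x_1y_1+\dots+x_ny_n-x_{n+1}y_{n+1}$, with its usual Lie group topology, and let $\mathbb{H}^n=\{x : \langle x,x\rangle=-1,\ x_{n+1}>0\}$. For a group $\Gamma$, a topological group $G$ and homomorphisms $\rho,\rho':\Gamma\to G$, the action of $\Gamma$ on $G$ by right-and-left multiplication via $(\rho,\rho')$ is $\gamma\cdot g=\rho'(\gamma)\,g\,\rho(\gamma)^{-1}$. It is properly discontinuous if for all compact $K,L\subset G$ the set $\{\gamma\in\Gamma : \gamma\cdot K\cap L\neq\varnothing\}$ is finite. A homomorphism is called faithful and discrete if it is injective and its image is a discrete subgroup. (a) Let $k\ge 6$ be even and let $\Gamma\subset\mathrm{O}(2,1)$ be the group generated by the orthogonal reflections in the sides of a compact convex right-angled $k$-gon of $\mathbb{H}^2$. Then there exist faithful and discrete homomorphisms $\rho,\rho':\Gamma\to\mathrm{O}(3,1)$ such that the action of $\Gamma$ on $\mathrm{O}(3,1)$ by right-and-left multiplication via $(\rho,\rho')$ is properly discontinuous. (b)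 Let $\Gamma\subset\mathrm{O}(4,1)$ be the group generated by the orthogonal reflections in the $120$ three-dimensional faces of a compact regular right-angled $120$-cell of $\mathbb{H}^4$. Then there exist faithful and discrete homomorphisms $\rho,\rho':\Gamma\to\mathrm{O}(8,1)$ such that the action of $\Gamma$ on $\mathrm{O}(8,1)$ by right-and-left multiplication via $(\rho,\rho')$ is properly discontinuous. -/

import Mathlib

open Matrix

noncomputable section

namespace RightAngledReflection

/-- The standard symmetric bilinear form of signature `(n, 1)` on `ℝ^{n,1}`, that is
`⟨x, y⟩ = x₁ y₁ + ⋯ + xₙ yₙ - xₙ₊₁ yₙ₊₁`. -/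
def form {n : ℕ} (x y : Fin n ⊕ Fin 1 → ℝ) : ℝ :=
  x ⬝ᵥ (LieAlgebra.Orthogonal.indefiniteDiagonal (Fin n) (Fin 1) ℝ *ᵥ y)

/-- Real hyperbolic space `ℍⁿ`, as the upper sheet of the hyperboloid in `ℝ^{n,1}`. -/
def hyperbolicSpace (n : ℕ) : Set (Fin n ⊕ Fin 1 → ℝ) :=
  {x | form x x = -1 ∧ 0 < x (Sum.inr 0)}

/-- The Lie group `O(n, 1)`, with the topology induced by the one of `GL(n + 1, ℝ)`. -/
def O (n : ℕ) : Subgroup (GL (Fin n ⊕ Fin 1) ℝ) where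
  carrier := {g | (g : Matrix _ _ ℝ)ᵀ * LieAlgebra.Orthogonal.indefiniteDiagonal (Fin n) (Fin 1) ℝ
    * (g : Matrix _ _ ℝ) = LieAlgebra.Orthogonal.indefiniteDiagonal (Fin n) (Fin 1) ℝ}
  one_mem' := by simp
  mul_mem' := by
    intro a b ha hb
    simp only [Set.mem_ofPred_eq, Units.val_mul, Matrix.transpose_mul] at *
    calc _ = (b : Matrix _ _ ℝ)ᵀ * ((a : Matrix _ _ ℝ)ᵀ *
          LieAlgebra.Orthogonal.indefiniteDiagonal (Fin n) (Fin 1) ℝ * (a : Matrix _ _ ℝ)) *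
          (b : Matrix _ _ ℝ) := by simp only [Matrix.mul_assoc]
      _ = _ := by rw [ha, hb]
  inv_mem' := by
    intro a ha
    simp only [Set.mem_ofPred_eq] at *
    have h1 : a.val * (a⁻¹).val = 1 := Units.mul_inv a
    have h2 : ((a⁻¹).val)ᵀ * (a.val)ᵀ = 1 := by
      rw [← Matrix.transpose_mul, h1, Matrix.transpose_one]
    set b := (a⁻¹).val
    set c := a.val
    set J := LieAlgebra.Orthogonal.indefiniteDiagonal (Fin n) (Fin 1) ℝ
    calc bᵀ * J * b = bᵀ * (cᵀ * J * c) * b := by rw [ha]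
      _ = (bᵀ * cᵀ) * J * (c * b) := by simp only [Matrix.mul_assoc]
      _ = J := by rw [h1, h2, Matrix.one_mul, Matrix.mul_one]

/-- The linear action of `O(n, 1)` on `ℝ^{n,1}`. -/
def act {n : ℕ} (g : O n) (x : Fin n ⊕ Fin 1 → ℝ) : Fin n ⊕ Fin 1 → ℝ :=
  ((g : GL (Fin n ⊕ Fin 1) ℝ) : Matrix (Fin n ⊕ Fin 1) (Fin n ⊕ Fin 1) ℝ) *ᵥ x

/-- The matrix of `x ↦ x - (2 ⟨v, x⟩ / ⟨v, v⟩) v` (which is the identity if `⟨v, v⟩ = 0`). -/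
def reflectionMatrix {n : ℕ} (v : Fin n ⊕ Fin 1 → ℝ) :
    Matrix (Fin n ⊕ Fin 1) (Fin n ⊕ Fin 1) ℝ :=
  1 - (2 / form v v) •
    vecMulVec v (LieAlgebra.Orthogonal.indefiniteDiagonal (Fin n) (Fin 1) ℝ *ᵥ v)

theorem indefiniteDiagonal_transpose (n : ℕ) :
    (LieAlgebra.Orthogonal.indefiniteDiagonal (Fin n) (Fin 1) ℝ)ᵀ =
      LieAlgebra.Orthogonal.indefiniteDiagonal (Fin n) (Fin 1) ℝ := by
  simp [LieAlgebra.Orthogonal.indefiniteDiagonal]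

theorem form_comm {n : ℕ} (x y : Fin n ⊕ Fin 1 → ℝ) : form x y = form y x := by
  unfold form
  rw [Matrix.dotProduct_mulVec, dotProduct_comm, ← Matrix.mulVec_transpose,
    indefiniteDiagonal_transpose]

theorem reflectionMatrix_mulVec {n : ℕ} (v x : Fin n ⊕ Fin 1 → ℝ) :
    reflectionMatrix v *ᵥ x = x - (2 * form v x / form v v) • v := by
  have h : (LieAlgebra.Orthogonal.indefiniteDiagonal (Fin n) (Fin 1) ℝ *ᵥ v) ⬝ᵥ x = form v x := by
    rw [dotProduct_comm, form_comm]; rfl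
  rw [reflectionMatrix, Matrix.sub_mulVec, Matrix.one_mulVec, Matrix.smul_mulVec,
    Matrix.vecMulVec_mulVec, h]
  ext i
  simp
  ring

theorem form_sub_smul {n : ℕ} (v x y : Fin n ⊕ Fin 1 → ℝ) (a b : ℝ) :
    form (x - a • v) (y - b • v) =
      form x y - b * form x v - a * form v y + a * b * form v v := by
  simp only [form, Matrix.mulVec_sub, Matrix.mulVec_smul, sub_dotProduct, dotProduct_sub,
    smul_dotProduct, dotProduct_smul, smul_eq_mul]
  ring

theorem reflectionMatrix_mul_self {n : ℕ} (v : Fin n ⊕ Fin 1 → ℝ) :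
    reflectionMatrix v * reflectionMatrix v = 1 := by
  apply Matrix.ext_of_mulVec_single
  intro i
  rw [← Matrix.mulVec_mulVec, Matrix.one_mulVec, reflectionMatrix_mulVec,
    reflectionMatrix_mulVec]
  set x : Fin n ⊕ Fin 1 → ℝ := Pi.single i 1
  by_cases h : form v v = 0
  · simp [h]
  · have : form v (x - (2 * form v x / form v v) • v) = - form v x := by
      have := form_sub_smul v v x 0 (2 * form v x / form v v)
      simp only [zero_smul, sub_zero] at this
      rw [this]; field_simp; ring
    rw [this]
    ext j
    simp
    ring

/-- The orthogonal reflection in the hyperplane `v^⊥` of `ℝ^{n,1}`, as an element of `O(n, 1)`. It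
induces the reflection of `ℍⁿ` in the hyperplane `ℍⁿ ∩ v^⊥` when `⟨v, v⟩ > 0`. -/
def reflection {n : ℕ} (v : Fin n ⊕ Fin 1 → ℝ) : O n :=
  ⟨⟨reflectionMatrix v, reflectionMatrix v, reflectionMatrix_mul_self v,
    reflectionMatrix_mul_self v⟩, by
    change (reflectionMatrix v)ᵀ * LieAlgebra.Orthogonal.indefiniteDiagonal (Fin n) (Fin 1) ℝ
      * reflectionMatrix v = LieAlgebra.Orthogonal.indefiniteDiagonal (Fin n) (Fin 1) ℝ
    have key : ∀ x y, form (reflectionMatrix v *ᵥ x) (reflectionMatrix v *ᵥ y) = form x y := by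
      intro x y
      rw [reflectionMatrix_mulVec, reflectionMatrix_mulVec, form_sub_smul, form_comm x v]
      by_cases h : form v v = 0
      · simp [h]
      · field_simp; ring
    ext i j
    have := key (Pi.single i 1) (Pi.single j 1)
    unfold form at this
    rw [Matrix.mulVec_mulVec, Matrix.dotProduct_mulVec, ← Matrix.vecMul_transpose,
      Matrix.vecMul_vecMul, ← Matrix.mul_assoc] at this
    simpa using this⟩

/-! ### Convex polygons of the hyperbolic plane -/

/-- A (compact) convex `k`-gon of `ℍ²`, for `k ≥ 3`, given by its cyclically ordered vertices. The
`i`-th side is the segment from vertex `i` to vertex `i + 1`; it is supported by the geodesic line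
`ℍ² ∩ (normal i)^⊥`, all other vertices lie strictly on one side of this line, and `normal i`
(uniquely determined by the vertices) is the unit normal vector pointing to the other side. -/
structure ConvexPolygon (k : ℕ) where
  vertex : ZMod k → Fin 2 ⊕ Fin 1 → ℝ
  normal : ZMod k → Fin 2 ⊕ Fin 1 → ℝ
  vertex_mem : ∀ i, vertex i ∈ hyperbolicSpace 2
  normal_unit : ∀ i, form (normal i) (normal i) = 1
  normal_left : ∀ i, form (vertex i) (normal i) = 0
  normal_right : ∀ i, form (vertex (i + 1)) (normal i) = 0
  strictly_inside : ∀ i j, j ≠ i → j ≠ i + 1 → form (vertex j) (normal i) < 0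

/-- All angles are right: the two sides meeting at vertex `i + 1` are orthogonal, for all `i`. -/
def ConvexPolygon.IsRightAngled {k : ℕ} (P : ConvexPolygon k) : Prop :=
  ∀ i, form (P.normal i) (P.normal (i + 1)) = 0

/-- The group generated by the reflections in the sides of a convex polygon of `ℍ²`. -/
def ConvexPolygon.reflectionGroup {k : ℕ} (P : ConvexPolygon k) : Subgroup (O 2) :=
  Subgroup.closure (Set.range fun i => reflection (P.normal i))

/-! ### Regular 120-cells of hyperbolic 4-space -/

/-- Representatives of the normal vectors of the regular Euclidean 120-cell. -/
def cellRow : Fin 3 → Fin 4 → ℝ :=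
  ![![0, 0, 0, 1],
    ![1 / 2, 1 / 2, 1 / 2, 1 / 2],
    ![0, Real.goldenRatio⁻¹ / 2, 1 / 2, Real.goldenRatio / 2]]

/-- The 120 unit vectors obtained from the rows above by sign changes and even permutations of the
coordinates. For `r > 0`, the inequalities `⟨w, y⟩ ≤ r`, where `w` runs through these vectors,
define a regular 120-cell of `ℝ⁴` centered at the origin. -/
def cellNormals : Set (Fin 4 → ℝ) :=
  {w | ∃ a : Fin 3, ∃ ε : Fin 4 → ℤˣ, ∃ σ ∈ alternatingGroup (Fin 4),
    ∀ i, w i = ((ε i : ℤ) : ℝ) * cellRow a (σ i)}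

/-- A regular 120-cell of `ℍ⁴`: the image by an isometry of `ℍ⁴` of a 120-cell which, in the
projective (Klein) model of `ℍ⁴` as the open unit ball of `ℝ⁴`, is a regular Euclidean 120-cell
centered at the origin, of inradius `r` and contained in the open unit ball. -/
structure Regular120Cell where
  isometry : O 4
  isometry_mem : ∀ x ∈ hyperbolicSpace 4, act isometry x ∈ hyperbolicSpace 4
  r : ℝ
  r_pos : 0 < r
  subset_ball : ∀ y : Fin 4 → ℝ, (∀ w ∈ cellNormals, w ⬝ᵥ y ≤ r) → y ⬝ᵥ y < 1

namespace Regular120Cell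

/-- The outward normal vector to the face with index `w`. (For a point of `ℍ⁴` proportional to
`(y, 1)`, the sign of its product with `(w, r)` is the one of `⟨w, y⟩ - r`.) -/
def normal (P : Regular120Cell) (w : cellNormals) : Fin 4 ⊕ Fin 1 → ℝ :=
  act P.isometry (Sum.elim (w : Fin 4 → ℝ) (fun _ => P.r))

/-- The 120-cell as a subset of `ℍ⁴`. -/
def body (P : Regular120Cell) : Set (Fin 4 ⊕ Fin 1 → ℝ) :=
  {x ∈ hyperbolicSpace 4 | ∀ w, form x (P.normal w) ≤ 0}

/-- The 3-dimensional face (a dodecahedron) with index `w`. -/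
def face (P : Regular120Cell) (w : cellNormals) : Set (Fin 4 ⊕ Fin 1 → ℝ) :=
  {x ∈ P.body | form x (P.normal w) = 0}

/-- Any two distinct faces that meet are orthogonal. -/
def IsRightAngled (P : Regular120Cell) : Prop :=
  ∀ w w', w ≠ w' → (P.face w ∩ P.face w').Nonempty → form (P.normal w) (P.normal w') = 0

/-- The group generated by the reflections in the faces of a regular 120-cell of `ℍ⁴`. -/
def reflectionGroup (P : Regular120Cell) : Subgroup (O 4) :=
  Subgroup.closure (Set.range fun w => reflection (P.normal w))

end Regular120Cell

/-! ### Actions by right-and-left multiplication -/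

/-- The action of `Γ` on `G` by right-and-left multiplication via a pair of homomorphisms:
`γ • g = ρ' γ * g * (ρ γ)⁻¹`. -/
@[reducible] def rightLeftAction {Γ G : Type*} [Group Γ] [Group G] (ρ ρ' : Γ →* G) :
    MulAction Γ G where
  smul γ g := ρ' γ * g * (ρ γ)⁻¹
  one_smul g := by
    change ρ' 1 * g * (ρ 1)⁻¹ = g
    simp
  mul_smul a b g := by
    change ρ' (a * b) * g * (ρ (a * b))⁻¹ = ρ' a * (ρ' b * g * (ρ b)⁻¹) * (ρ a)⁻¹
    simp [mul_assoc]

/-- The action of `Γ` on `G` by right-and-left multiplication via `(ρ, ρ')` is properly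
discontinuous: for all compact subsets `K`, `L` of `G`, only finitely many `γ` satisfy
`γ • K ∩ L ≠ ∅`. -/
def ActsProperlyDiscontinuously {Γ G : Type*} [Group Γ] [Group G] [TopologicalSpace G]
    (ρ ρ' : Γ →* G) : Prop :=
  @ProperlyDiscontinuousSMul Γ G _ (rightLeftAction ρ ρ').toSMul

/-- A representation is faithful and discrete if it is injective and its image is a discrete
subgroup. -/
def IsFaithfulDiscrete {Γ G : Type*} [Group Γ] [Group G] [TopologicalSpace G] (ρ : Γ →* G) : Prop :=
  Function.Injective ρ ∧ DiscreteTopology ρ.range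

end RightAngledReflection

end

/-!
# Proper actions by right-and-left multiplication obtained by bending reflection groups

Let `Γ` be generated by the reflections in the walls `(v i)^⊥` of a right-angled polytope of `ℍⁿ`,
and suppose that its walls are coloured with `m + 1` colours so that orthogonal walls have
different colours (`2` colours for a polygon with an even number of sides, `5` for the 120-cell).
Choose an interior point as origin, so that all `v i` have a positive time coordinate `ℓ i`. Give
each colour `a` its own direction in `ℝᵐ`, namely the vertex `e a` of a regular simplex, and
replace `v i` by the vector `v' i` of `ℝ^{n+m,1}` (`bend`) with the space coordinates of
`v i` and of `(t * ℓ i) • e a`, where `a` is the colour of `i`, and with time coordinate `σ * ℓ i`.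
With `σ ^ 2 = 1 - t ^ 2 / (m + 1)` this changes the products of vectors of the same colour only, by
`t ^ 2 * ℓ i * ℓ j` (`form_bend`). Distinct walls of the same colour are at positive distance,
so for small `t` the new vectors are again the normals of a right-angled reflection group. Tits'
argument on roots (`IsRightAngledSystem.act_rep_mem_posCone`) identifies both groups with the
abstract right-angled Coxeter group and shows that both representations are faithful and discrete.

The linear map `T` that dilates the time axis of `ℝ^{n,1}` by `σ⁻¹` and embeds it into `ℝ^{n+m,1}`
satisfies `⟨T x, v' i⟩ = ⟨x, v i⟩`, so it maps walls into walls, and in the Klein model it is the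
homothety of ratio `σ < 1`, which contracts hyperbolic distances by a factor `c < 1`
(`exists_hdist_map_le`). Cutting the geodesic from `x` to `γ y` where it crosses walls, one sees
that the equivariant extension of `T` from the chamber contracts distances as well
(`hdist_act_rep_le`). Hence the bent representation `ρ'` displaces points at most `c` times as much
as the original one `ρ`; if `ρ' γ * k = l * ρ γ` with `k` and `l` in compact sets, the displacement
of `ρ γ` is then bounded, which leaves finitely many `γ`
(`actsProperlyDiscontinuously_of_contraction`).

It remains to see that walls that are not orthogonal are at positive distance. For polygons this
follows from alternating projections between two sides
(`ConvexPolygon.IsRightAngled.form_normal_lt`). For the 120-cell, twice the products of the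
Euclidean normals are elements of `ℤ[φ]` bounded by `2` together with their conjugates
(`dotProduct_cellNormals`), and right angles force `r ^ 2 = φ / 2`. The normals form the binary
icosahedral group, and the colours are the five cosets of the binary tetrahedral group: within a
coset the products are rational (`cellColor_ne`).
-/

noncomputable section

namespace RightAngledReflection

/-! ### The Lorentzian form -/

section Form

variable {n : ℕ} (x y z : Fin n ⊕ Fin 1 → ℝ) (a : ℝ)

theorem form_add_left : form (x + y) z = form x z + form y z := by
  simp [form, add_dotProduct]

theorem form_add_right : form x (y + z) = form x y + form x z := by
  simp [form, Matrix.mulVec_add, dotProduct_add]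

theorem form_sub_left : form (x - y) z = form x z - form y z := by
  simp [form, sub_dotProduct]

theorem form_sub_right : form x (y - z) = form x y - form x z := by
  simp [form, Matrix.mulVec_sub, dotProduct_sub]

theorem form_neg_left : form (-x) y = -form x y := by
  simp [form]

theorem form_neg_right : form x (-y) = -form x y := by
  simp [form, Matrix.mulVec_neg]

theorem form_smul_left : form (a • x) y = a * form x y := by
  simp [form, smul_dotProduct]

theorem form_smul_right : form x (a • y) = a * form x y := by
  simp [form, Matrix.mulVec_smul, dotProduct_smul]

@[simp] theorem form_zero_left : form 0 x = 0 := by simp [form]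

@[simp] theorem form_zero_right : form x 0 = 0 := by simp [form]

theorem form_eq_sum :
    form x y = ∑ i, x (Sum.inl i) * y (Sum.inl i) - x (Sum.inr 0) * y (Sum.inr 0) := by
  simp [form, LieAlgebra.Orthogonal.indefiniteDiagonal, Matrix.mulVec_diagonal, dotProduct,
    Fintype.sum_sum_type, sub_eq_add_neg]

end Form

section Act

variable {n : ℕ} (g h : O n) (x y : Fin n ⊕ Fin 1 → ℝ)

theorem act_mul : act (g * h) x = act g (act h x) := by
  simp [act, Matrix.mulVec_mulVec]

@[simp] theorem act_one : act (1 : O n) x = x := by simp [act]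

theorem act_add : act g (x + y) = act g x + act g y := by simp [act, Matrix.mulVec_add]

theorem act_neg : act g (-x) = -act g x := by simp [act, Matrix.mulVec_neg]

theorem act_smul (a : ℝ) : act g (a • x) = a • act g x := by simp [act, Matrix.mulVec_smul]

theorem act_act_inv : act g (act g⁻¹ x) = x := by rw [← act_mul]; simp

theorem form_act : form (act g x) (act g y) = form x y := by
  have hg : (g.1.1)ᵀ * LieAlgebra.Orthogonal.indefiniteDiagonal (Fin n) (Fin 1) ℝ * g.1.1 =
    LieAlgebra.Orthogonal.indefiniteDiagonal (Fin n) (Fin 1) ℝ := g.2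
  unfold form act
  conv_rhs => rw [← hg]
  rw [← Matrix.mulVec_mulVec, ← Matrix.mulVec_mulVec, Matrix.dotProduct_mulVec x,
    Matrix.vecMul_transpose]

theorem form_act_left : form (act g x) y = form x (act g⁻¹ y) := by
  rw [← form_act g x, act_act_inv]

theorem act_reflection (v : Fin n ⊕ Fin 1 → ℝ) :
    act (reflection v) x = x - (2 * form v x / form v v) • v :=
  reflectionMatrix_mulVec v x

theorem act_injective : Function.Injective (act (n := n)) := by
  intro g h hgh
  apply Subtype.ext
  apply Units.ext
  exact Matrix.ext_of_mulVec_single fun i => congrFun hgh _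

theorem continuous_form_act :
    Continuous fun g : O n => form (act g x) y := by
  unfold form act
  have : Continuous fun g : O n => (g.1.1 : Matrix (Fin n ⊕ Fin 1) (Fin n ⊕ Fin 1) ℝ) :=
    Units.continuous_val.comp continuous_subtype_val
  exact (this.matrix_mulVec continuous_const).dotProduct continuous_const

theorem reflection_smul (v : Fin n ⊕ Fin 1 → ℝ) {a : ℝ} (ha : a ≠ 0) :
    reflection (a • v) = reflection v := by
  apply act_injective
  ext x i
  rw [act_reflection, act_reflection, form_smul_left, form_smul_left, form_smul_right]
  by_cases hv : form v v = 0
  · simp [hv]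
  · simp only [Pi.sub_apply, Pi.smul_apply, smul_eq_mul]
    field_simp

theorem reflection_mul_self (v : Fin n ⊕ Fin 1 → ℝ) : reflection v * reflection v = 1 := by
  apply Subtype.ext
  apply Units.ext
  exact reflectionMatrix_mul_self v

theorem reflection_mul_comm {v w : Fin n ⊕ Fin 1 → ℝ} (h : form v w = 0) :
    reflection v * reflection w = reflection w * reflection v := by
  apply act_injective
  ext x i
  simp only [act_mul, act_reflection, form_sub_right, form_smul_right, h, form_comm w v]
  simp
  ring

end Act

/-! ### Right-angled Coxeter groups and their linear reflection representations -/

section Coxeter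

variable {I : Type*}

open Classical in
/-- The Coxeter matrix of the right-angled Coxeter group in which two generators commute exactly
when they are adjacent in the graph `G`. As usual in Mathlib, `0` encodes the absence of a
relation. -/
def rightAngledMatrix (G : SimpleGraph I) : CoxeterMatrix I where
  M := Matrix.of fun i j => if i = j then 1 else if G.Adj i j then 2 else 0
  isSymm := by
    ext i j
    simp [Matrix.transpose_apply, G.adj_comm, eq_comm]
  diagonal := by simp
  off_diagonal := by
    intro i j h
    simp only [Matrix.of_apply, h, if_false]
    split_ifs <;> simp

/-- The right-angled Coxeter system defined by the graph `G`. -/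
abbrev cox (G : SimpleGraph I) : CoxeterSystem (rightAngledMatrix G) (rightAngledMatrix G).Group :=
  (rightAngledMatrix G).toCoxeterSystem

/-- Unit spacelike vectors whose Gram matrix makes the associated reflections generate a
right-angled reflection group with commutation graph `G`: the hyperplanes of adjacent vectors are
orthogonal, those of distinct nonadjacent ones do not cross. -/
structure IsRightAngledSystem {n : ℕ} (G : SimpleGraph I) (v : I → Fin n ⊕ Fin 1 → ℝ) : Prop where
  unit : ∀ i, form (v i) (v i) = 1
  adj : ∀ i j, G.Adj i j → form (v i) (v j) = 0
  not_adj : ∀ i j, i ≠ j → ¬ G.Adj i j → form (v i) (v j) ≤ -1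

namespace IsRightAngledSystem

variable {n : ℕ} {G : SimpleGraph I} {v : I → Fin n ⊕ Fin 1 → ℝ}

theorem isLiftable (hv : IsRightAngledSystem G v) :
    (rightAngledMatrix G).IsLiftable fun i => reflection (v i) := by
  classical
  intro i j
  by_cases hij : i = j
  · subst hij
    rw [reflection_mul_self, one_pow]
  · by_cases h : G.Adj i j
    · have hM : (rightAngledMatrix G) i j = 2 := by
        simp [rightAngledMatrix, hij, h]
      have hc : Commute (reflection (v i)) (reflection (v j)) :=
        reflection_mul_comm (hv.adj i j h)
      rw [hM, hc.mul_pow, pow_two, pow_two, reflection_mul_self, reflection_mul_self, one_mul]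
    · have hM : (rightAngledMatrix G) i j = 0 := by
        simp [rightAngledMatrix, hij, h]
      rw [hM, pow_zero]

/-- The representation of the right-angled Coxeter group that sends the generators to the
reflections in the given vectors. -/
def rep (hv : IsRightAngledSystem G v) : (rightAngledMatrix G).Group →* O n :=
  (cox G).lift ⟨fun i => reflection (v i), hv.isLiftable⟩

theorem rep_simple (hv : IsRightAngledSystem G v) (i : I) :
    hv.rep ((cox G).simple i) = reflection (v i) :=
  (cox G).lift_apply_simple hv.isLiftable i

theorem act_rep_simple (hv : IsRightAngledSystem G v) (i : I) (x : Fin n ⊕ Fin 1 → ℝ) :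
    act (hv.rep ((cox G).simple i)) x = x - (2 * form (v i) x) • v i := by
  rw [rep_simple, act_reflection, hv.unit, div_one]

end IsRightAngledSystem

/-- The (nonzero) vectors that behave like nonnegative combinations of the `v i`, described by
duality: their product with a vector `p` is nonpositive if all `⟨p, v i⟩` are, and negative if all
`⟨p, v i⟩` are. -/
def posCone {n : ℕ} (v : I → Fin n ⊕ Fin 1 → ℝ) : Set (Fin n ⊕ Fin 1 → ℝ) :=
  {x | (∀ p, (∀ i, form p (v i) ≤ 0) → form p x ≤ 0) ∧
    ∀ p, (∀ i, form p (v i) < 0) → form p x < 0}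

theorem smul_add_smul_mem_posCone {n : ℕ} {v : I → Fin n ⊕ Fin 1 → ℝ} {x y : Fin n ⊕ Fin 1 → ℝ}
    (hx : x ∈ posCone v) (hy : y ∈ posCone v) {a b : ℝ} (hb : 0 < b) (ha : 0 ≤ a) :
    b • x + a • y ∈ posCone v := by
  refine ⟨fun p hp => ?_, fun p hp => ?_⟩ <;>
    rw [form_add_right, form_smul_right, form_smul_right]
  · nlinarith [hx.1 p hp, hy.1 p hp]
  · nlinarith [hx.2 p hp, hy.2 p hp]

namespace IsRightAngledSystem

variable {n : ℕ} {G : SimpleGraph I} {v : I → Fin n ⊕ Fin 1 → ℝ}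

/-- Tits' positivity of roots: if `ℓ(ws) > ℓ(w)` then `w(v s)` is a positive root. The second
clause, about the span of two generators without relation, makes the induction on `ℓ(w)` work. -/
theorem act_rep_mem_posCone_aux (hv : IsRightAngledSystem G v) (m : ℕ) :
    ∀ w, (cox G).length w = m → ∀ s, ¬ (cox G).IsRightDescent w s →
      act (hv.rep w) (v s) ∈ posCone v ∧
      ∀ t, s ≠ t → ¬ G.Adj s t → ∀ a b : ℝ, 0 ≤ a → a ≤ b → 0 < b →
        act (hv.rep w) (b • v s + a • v t) ∈ posCone v := by
  induction m using Nat.strong_induction_on with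
  | _ m ih =>
  intro w hw
  -- Moving a generator `t` with `ℓ(wt) < ℓ(w)` from the end of `w` to the vector.
  have key : ∀ s, ¬ (cox G).IsRightDescent w s → ∀ t, s ≠ t → ¬ G.Adj s t →
      (cox G).IsRightDescent w t → ∀ a b : ℝ, 0 ≤ a → a ≤ b → 0 < b →
        act (hv.rep w) (b • v s + a • v t) ∈ posCone v := by
    intro s hs t hst hadj ht a b ha hab hb
    have hu : ¬ (cox G).IsRightDescent (w * (cox G).simple t) t :=
      (cox G).isRightDescent_iff_not_isRightDescent_mul.1 ht
    have hlt : (cox G).length (w * (cox G).simple t) < m := hw ▸ ht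
    have hg : form (v t) (v s) ≤ -1 := by rw [form_comm]; exact hv.not_adj s t hst hadj
    have := ((ih _ hlt _ rfl t hu).2 s hst.symm (fun h => hadj h.symm) b
      (-2 * b * form (v t) (v s) - a) hb.le (by nlinarith) (by nlinarith))
    convert this using 1
    have hw' : w = (w * (cox G).simple t) * (cox G).simple t :=
      ((cox G).simple_mul_simple_cancel_right t).symm
    conv_lhs => rw [hw', map_mul, act_mul, act_rep_simple]
    congr 1
    rw [form_add_right, form_smul_right, form_smul_right, hv.unit]
    ext i
    simp
    ring
  have first : ∀ s, ¬ (cox G).IsRightDescent w s → act (hv.rep w) (v s) ∈ posCone v := by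
    intro s hs
    by_cases h1 : w = 1
    · subst h1
      rw [map_one, act_one]
      exact ⟨fun p hp => hp s, fun p hp => hp s⟩
    obtain ⟨t, ht⟩ := (cox G).exists_rightDescent_of_ne_one h1
    have hst : s ≠ t := fun h => hs (h ▸ ht)
    by_cases hadj : G.Adj s t
    · have hlt : (cox G).length (w * (cox G).simple t) < m := hw ▸ ht
      have hcomm : (cox G).simple t * (cox G).simple s = (cox G).simple s * (cox G).simple t := by
        have := (cox G).simple_mul_simple_pow s t
        have hM : (rightAngledMatrix G) s t = 2 := by
          classical simp [rightAngledMatrix, hst, hadj]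
        rw [hM, pow_two, mul_eq_one_iff_eq_inv, _root_.mul_inv_rev, (cox G).inv_simple,
          (cox G).inv_simple] at this
        exact this.symm
      have hus : ¬ (cox G).IsRightDescent (w * (cox G).simple t) s := by
        intro h
        unfold CoxeterSystem.IsRightDescent at h
        rw [mul_assoc, hcomm, ← mul_assoc] at h
        have h2 := (cox G).length_mul_simple (w * (cox G).simple s) t
        have h3 := (cox G).not_isRightDescent_iff.1 hs
        omega
      have := (ih _ hlt _ rfl s hus).1
      convert this using 1
      rw [map_mul, act_mul, act_rep_simple, form_comm, hv.adj s t hadj]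
      simp
    · have := key s hs t hst hadj ht 0 1 le_rfl zero_le_one one_pos
      simpa using this
  refine fun s hs => ⟨first s hs, fun t hst hadj a b ha hab hb => ?_⟩
  by_cases ht : (cox G).IsRightDescent w t
  · exact key s hs t hst hadj ht a b ha hab hb
  · rw [act_add, act_smul, act_smul]
    exact smul_add_smul_mem_posCone (first s hs) (first t ht) hb ha

theorem act_rep_mem_posCone (hv : IsRightAngledSystem G v) {w : (rightAngledMatrix G).Group} {s : I}
    (h : ¬ (cox G).IsRightDescent w s) : act (hv.rep w) (v s) ∈ posCone v :=
  (hv.act_rep_mem_posCone_aux _ w rfl s h).1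

theorem neg_act_rep_mem_posCone (hv : IsRightAngledSystem G v) {w : (rightAngledMatrix G).Group}
    {s : I} (h : (cox G).IsRightDescent w s) : -act (hv.rep w) (v s) ∈ posCone v := by
  have := hv.act_rep_mem_posCone ((cox G).isRightDescent_iff_not_isRightDescent_mul.1 h)
  convert this using 1
  rw [map_mul, act_mul, act_rep_simple, hv.unit, ← act_neg]
  congr 1
  ext i
  simp
  ring

/-- The translate by `w` of the chamber lies on the negative side of the wall `s` unless
`ℓ(sw) < ℓ(w)`. -/
theorem isLeftDescent_of_form_pos (hv : IsRightAngledSystem G v) {w : (rightAngledMatrix G).Group}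
    {s : I} {y : Fin n ⊕ Fin 1 → ℝ} (hy : ∀ i, form y (v i) ≤ 0)
    (h : 0 < form (act (hv.rep w) y) (v s)) : (cox G).IsLeftDescent w s := by
  by_contra hs
  rw [← (cox G).isRightDescent_inv_iff] at hs
  have := (hv.act_rep_mem_posCone hs).1 y hy
  rw [form_act_left, ← map_inv] at h
  linarith

theorem form_nonneg_of_isLeftDescent (hv : IsRightAngledSystem G v)
    {w : (rightAngledMatrix G).Group}
    {s : I} {y : Fin n ⊕ Fin 1 → ℝ} (hy : ∀ i, form y (v i) ≤ 0)
    (h : (cox G).IsLeftDescent w s) : 0 ≤ form (act (hv.rep w) y) (v s) := by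
  rw [← (cox G).isRightDescent_inv_iff] at h
  have := (hv.neg_act_rep_mem_posCone h).1 y hy
  rw [form_neg_right] at this
  rw [form_act_left, ← map_inv]
  linarith

/-- Only the identity maps an interior point of the chamber into the interior of the chamber. -/
theorem eq_one_of_form_act_neg (hv : IsRightAngledSystem G v) {w : (rightAngledMatrix G).Group}
    {p : Fin n ⊕ Fin 1 → ℝ} (hp : ∀ i, form p (v i) < 0)
    (h : ∀ i, form (act (hv.rep w) p) (v i) < 0) : w = 1 := by
  by_contra h1
  obtain ⟨s, hs⟩ := (cox G).exists_leftDescent_of_ne_one h1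
  exact absurd (hv.form_nonneg_of_isLeftDescent (fun i => (hp i).le) hs) (not_le.2 (h s))

theorem rep_injective (hv : IsRightAngledSystem G v) {p : Fin n ⊕ Fin 1 → ℝ}
    (hp : ∀ i, form p (v i) < 0) : Function.Injective hv.rep := by
  rw [injective_iff_map_eq_one]
  intro w hw
  exact hv.eq_one_of_form_act_neg hp (by simpa [hw] using hp)

theorem discreteTopology_range_rep [Finite I] (hv : IsRightAngledSystem G v)
    {p : Fin n ⊕ Fin 1 → ℝ} (hp : ∀ i, form p (v i) < 0) : DiscreteTopology hv.rep.range := by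
  apply discreteTopology_of_isOpen_singleton_one
  have hopen : IsOpen {g : hv.rep.range | ∀ i, form (act g.1 p) (v i) < 0} := by
    have : {g : hv.rep.range | ∀ i, form (act g.1 p) (v i) < 0} =
        ⋂ i, {g : hv.rep.range | form (act g.1 p) (v i) < 0} := by
      ext; simp
    rw [this]
    exact isOpen_iInter_of_finite fun i =>
      isOpen_lt ((continuous_form_act p (v i)).comp continuous_subtype_val) continuous_const
  convert hopen
  ext ⟨g, w, hw⟩
  subst hw
  simp only [Set.mem_singleton_iff, Set.mem_ofPred_eq]
  constructor
  · intro h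
    have h : hv.rep w = 1 := congrArg Subtype.val h
    simpa [h] using hp
  · intro h
    apply Subtype.ext
    simp [hv.eq_one_of_form_act_neg hp h]

theorem isFaithfulDiscrete_rep [Finite I] (hv : IsRightAngledSystem G v)
    {p : Fin n ⊕ Fin 1 → ℝ} (hp : ∀ i, form p (v i) < 0) : IsFaithfulDiscrete hv.rep :=
  ⟨hv.rep_injective hp, hv.discreteTopology_range_rep hp⟩

theorem range_rep (hv : IsRightAngledSystem G v) :
    hv.rep.range = Subgroup.closure (Set.range fun i => reflection (v i)) := by
  rw [MonoidHom.range_eq_map, ← (cox G).subgroup_closure_range_simple, MonoidHom.map_closure,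
    ← Set.range_comp]
  congr 2
  ext1 i
  exact hv.rep_simple i

end IsRightAngledSystem

end Coxeter

/-! ### Hyperbolic distance between timelike lines -/

section Distance

variable {n : ℕ} {x y z b p q u v : Fin n ⊕ Fin 1 → ℝ}

theorem form_self_nonneg_of_orthogonal (hb : form b b < 0) (h : form x b = 0) : 0 ≤ form x x := by
  rw [form_eq_sum] at *
  have hcs := Finset.sum_mul_sq_le_sq_mul_sq Finset.univ (fun i => x (Sum.inl i))
    (fun i => b (Sum.inl i))
  have hx : 0 ≤ ∑ i, x (Sum.inl i) ^ 2 := Finset.sum_nonneg fun i _ => sq_nonneg _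
  simp only [← pow_two] at *
  by_contra! hneg
  have hb0 : 0 < b (Sum.inr 0) ^ 2 := by
    have : 0 ≤ ∑ i, b (Sum.inl i) ^ 2 := Finset.sum_nonneg fun i _ => sq_nonneg _
    linarith
  have h1 : ∑ i, x (Sum.inl i) * b (Sum.inl i) = x (Sum.inr 0) * b (Sum.inr 0) := by linarith
  rw [h1] at hcs
  nlinarith

theorem form_sq_le_of_orthogonal (hb : form b b < 0) (hu : form u b = 0) (hv : form v b = 0) :
    form u v ^ 2 ≤ form u u * form v v := by
  have key : ∀ s : ℝ, 0 ≤ form v v * (s * s) + (2 * form u v) * s + form u u := by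
    intro s
    have h : form (u + s • v) b = 0 := by
      rw [form_add_left, form_smul_left, hu, hv]; simp
    have := form_self_nonneg_of_orthogonal hb h
    simp only [form_add_left, form_add_right, form_smul_left, form_smul_right, form_comm v u]
      at this
    linarith
  have := discrim_le_zero key
  unfold discrim at this
  nlinarith

/-- The length of a timelike vector. -/
def tlen (x : Fin n ⊕ Fin 1 → ℝ) : ℝ := √(-form x x)

theorem tlen_pos (hx : form x x < 0) : 0 < tlen x := Real.sqrt_pos.2 (by linarith)

theorem tlen_sq (hx : form x x < 0) : tlen x ^ 2 = -form x x := Real.sq_sqrt (by linarith)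

/-- The hyperbolic distance between the lines spanned by two timelike vectors; these vectors need
neither be normalized nor point to the future. -/
def hdist (x y : Fin n ⊕ Fin 1 → ℝ) : ℝ := Real.arcosh (|form x y| / (tlen x * tlen y))

theorem hdist_comm : hdist x y = hdist y x := by
  rw [hdist, hdist, form_comm, mul_comm]

theorem hdist_act (g : O n) : hdist (act g x) (act g y) = hdist x y := by
  simp only [hdist, tlen, form_act]

theorem one_le_of_timelike (hx : form x x < 0) (hy : form y y < 0) :
    1 ≤ |form x y| / (tlen x * tlen y) := by
  have hX := tlen_pos hx
  have hY := tlen_pos hy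
  rw [one_le_div (by positivity)]
  apply le_of_sq_le_sq _ (abs_nonneg _)
  rw [sq_abs]
  have h : form (x - (form x y / form y y) • y) y = 0 := by
    rw [form_sub_left, form_smul_left]
    field_simp [hy.ne]
    ring
  have h2 := form_self_nonneg_of_orthogonal hy h
  have h3 : form (x - (form x y / form y y) • y) (x - (form x y / form y y) • y) * form y y =
      form x x * form y y - form x y ^ 2 := by
    simp only [form_sub_left, form_sub_right, form_smul_left, form_smul_right, form_comm y x]
    field_simp [hy.ne]
    ring
  rw [mul_pow, tlen_sq hx, tlen_sq hy]
  nlinarith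

theorem hdist_nonneg (hx : form x x < 0) (hy : form y y < 0) : 0 ≤ hdist x y :=
  Real.arcosh_nonneg (one_le_of_timelike hx hy)

theorem cosh_hdist (hx : form x x < 0) (hy : form y y < 0) :
    Real.cosh (hdist x y) = |form x y| / (tlen x * tlen y) :=
  Real.cosh_arcosh (one_le_of_timelike hx hy)

theorem abs_form_eq (hx : form x x < 0) (hy : form y y < 0) :
    |form x y| = Real.cosh (hdist x y) * (tlen x * tlen y) := by
  have hX := tlen_pos hx
  have hY := tlen_pos hy
  rw [cosh_hdist hx hy]
  field_simp

/-- The component of `x` orthogonal to the timelike vector `p`. -/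
def orthPart (p x : Fin n ⊕ Fin 1 → ℝ) : Fin n ⊕ Fin 1 → ℝ := x - (form x p / form p p) • p

theorem form_orthPart_self (hp : form p p < 0) : form (orthPart p x) p = 0 := by
  rw [orthPart, form_sub_left, form_smul_left]
  field_simp [hp.ne]
  ring

theorem form_orthPart (hp : form p p < 0) :
    form (orthPart p x) (orthPart p y) = form x y - form x p * form p y / form p p := by
  simp only [orthPart, form_sub_left, form_sub_right, form_smul_left, form_smul_right,
    form_comm y p]
  field_simp [hp.ne]
  ring

theorem form_orthPart_orthPart (hp : form p p < 0) (hx : form x x < 0) :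
    form (orthPart p x) (orthPart p x) = (tlen x * Real.sinh (hdist x p)) ^ 2 := by
  have h1 : form x p ^ 2 = (Real.cosh (hdist x p) * (tlen x * tlen p)) ^ 2 := by
    rw [← abs_form_eq hx hp, sq_abs]
  have h2 := tlen_sq hp
  have h3 := tlen_sq hx
  have h4 := tlen_pos hp
  rw [form_orthPart hp, form_comm p x, ← pow_two, h1, mul_pow, mul_pow _ (Real.sinh _),
    Real.sinh_sq, show form p p = -tlen p ^ 2 by linarith, show form x x = -tlen x ^ 2 by linarith]
  field_simp
  ring

theorem hdist_triangle (hx : form x x < 0) (hp : form p p < 0) (hy : form y y < 0) :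
    hdist x y ≤ hdist x p + hdist p y := by
  have h0 := hdist_nonneg hx hp
  have h0' := hdist_nonneg hp hy
  rw [← abs_of_nonneg (hdist_nonneg hx hy), ← abs_of_nonneg (add_nonneg h0 h0'),
    ← Real.cosh_le_cosh, Real.cosh_add, cosh_hdist hx hy]
  have hX := tlen_pos hx
  have hY := tlen_pos hy
  have hP := tlen_pos hp
  rw [div_le_iff₀ (by positivity)]
  have hcs := form_sq_le_of_orthogonal hp (form_orthPart_self (x := x) hp)
    (form_orthPart_self (x := y) hp)
  rw [form_orthPart_orthPart hp hx, form_orthPart_orthPart hp hy, ← mul_pow] at hcs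
  have hs := abs_le_of_sq_le_sq hcs (by
    have := Real.sinh_nonneg_iff.2 h0
    have := Real.sinh_nonneg_iff.2 (hdist_comm (x := p) (y := y) ▸ h0')
    positivity)
  rw [form_orthPart hp] at hs
  have e1 := abs_form_eq hx hp
  have e2 := abs_form_eq hp hy
  have e3 : |form x p * form p y / form p p| =
      Real.cosh (hdist x p) * Real.cosh (hdist p y) * (tlen x * tlen y) := by
    rw [abs_div, abs_mul, e1, e2, abs_of_neg hp, ← tlen_sq hp]
    field_simp
  rw [hdist_comm (x := y)] at hs
  have := abs_sub_abs_le_abs_sub (form x y) (form x p * form p y / form p p)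
  rw [e3] at this
  linarith

/-- Timelike vectors pointing to the future. -/
def IsFuture (x : Fin n ⊕ Fin 1 → ℝ) : Prop := form x x < 0 ∧ 0 < x (Sum.inr 0)

theorem IsFuture.tlen_mul_tlen_le (hx : IsFuture x) (hy : IsFuture y) :
    tlen x * tlen y ≤ x (Sum.inr 0) * y (Sum.inr 0) := by
  have key : ∀ {z : Fin n ⊕ Fin 1 → ℝ}, IsFuture z → tlen z ≤ z (Sum.inr 0) := by
    intro z hz
    rw [tlen, Real.sqrt_le_left hz.2.le, form_eq_sum]
    have : 0 ≤ ∑ i, z (Sum.inl i) * z (Sum.inl i) := Finset.sum_nonneg fun i _ => mul_self_nonneg _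
    linarith
  exact mul_le_mul (key hx) (key hy) (Real.sqrt_nonneg _) hx.2.le

theorem IsFuture.form_neg (hx : IsFuture x) (hy : IsFuture y) : form x y < 0 := by
  obtain ⟨hx1, hx2⟩ := hx
  obtain ⟨hy1, hy2⟩ := hy
  rw [form_eq_sum] at *
  have hcs := Finset.sum_mul_sq_le_sq_mul_sq Finset.univ (fun i => x (Sum.inl i))
    (fun i => y (Sum.inl i))
  have hA : 0 ≤ ∑ i, x (Sum.inl i) ^ 2 := Finset.sum_nonneg fun i _ => sq_nonneg _
  have hB : 0 ≤ ∑ i, y (Sum.inl i) ^ 2 := Finset.sum_nonneg fun i _ => sq_nonneg _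
  simp only [← pow_two] at hx1 hy1
  have : (∑ i, x (Sum.inl i) * y (Sum.inl i)) ^ 2 < (x (Sum.inr 0) * y (Sum.inr 0)) ^ 2 := by
    refine hcs.trans_lt ?_
    rw [mul_pow]
    exact mul_lt_mul'' (by linarith) (by linarith) hA hB
  have := (abs_lt_of_sq_lt_sq this (by positivity))
  linarith [le_abs_self (∑ i, x (Sum.inl i) * y (Sum.inl i))]

theorem IsFuture.of_form_neg (hx : IsFuture x) (hy : form y y < 0) (h : form x y < 0) :
    IsFuture y := by
  refine ⟨hy, ?_⟩
  by_contra! h0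
  have h1 : 0 < (-y) (Sum.inr 0) := by
    rcases h0.lt_or_eq with h0 | h0
    · simpa using h0
    · exfalso
      rw [form_eq_sum, h0] at hy
      have : 0 ≤ ∑ i, y (Sum.inl i) * y (Sum.inl i) :=
        Finset.sum_nonneg fun i _ => mul_self_nonneg _
      linarith
  have := hx.form_neg (y := -y) ⟨by rwa [form_neg_left, form_neg_right, neg_neg], h1⟩
  rw [form_neg_right] at this
  linarith

theorem IsFuture.smul_add_smul (hx : IsFuture x) (hy : IsFuture y) {α β : ℝ} (hα : 0 ≤ α)
    (hβ : 0 ≤ β) (h : 0 < α + β) : IsFuture (α • x + β • y) := by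
  have h1 := hx.form_neg hy
  have hx1 := hx.1
  have hy1 := hy.1
  have hx2 := hx.2
  have hy2 := hy.2
  refine ⟨?_, ?_⟩
  · simp only [form_add_left, form_add_right, form_smul_left, form_smul_right, form_comm y x]
    rcases hα.lt_or_eq with h2 | h2
    · have : α * (α * form x x) < 0 := by nlinarith [mul_pos h2 h2]
      have : α * (β * form x y) ≤ 0 := by nlinarith [mul_nonneg hα hβ]
      have : β * (β * form y y) ≤ 0 := by nlinarith [mul_nonneg hβ hβ]
      nlinarith
    · subst h2
      have hβ' : 0 < β := by linarith
      have : β * (β * form y y) < 0 := by nlinarith [mul_pos hβ' hβ']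
      nlinarith
  · simp only [Pi.add_apply, Pi.smul_apply, smul_eq_mul]
    rcases hα.lt_or_eq with h2 | h2
    · have := mul_pos h2 hx2
      have := mul_nonneg hβ hy2.le
      linarith
    · subst h2
      have := mul_pos (by linarith : 0 < β) hy2
      linarith

theorem hdist_add_hdist_aux (hx : IsFuture x) (hy : IsFuture y) {α β : ℝ} (hα : 0 < α)
    (hβ : 0 ≤ β) : hdist x (α • x + β • y) + hdist (α • x + β • y) y = hdist x y := by
  have hp := hx.smul_add_smul hy hα.le hβ (by linarith)
  set p := α • x + β • y with hpdef
  have hxp := hx.form_neg hp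
  have hpy := hp.form_neg hy
  have hxy := hx.form_neg hy
  have h0 := hdist_nonneg hx.1 hp.1
  have h0' := hdist_nonneg hp.1 hy.1
  apply Real.cosh_injOn (Set.mem_Ici.2 (add_nonneg h0 h0')) (Set.mem_Ici.2 (hdist_nonneg hx.1 hy.1))
  have hX := tlen_pos hx.1
  have hY := tlen_pos hy.1
  have hP := tlen_pos hp.1
  have hS1 := Real.sinh_nonneg_iff.2 h0
  have hS2 := Real.sinh_nonneg_iff.2 h0'
  rw [Real.cosh_add, cosh_hdist hx.1 hy.1, eq_div_iff (by positivity)]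
  have hlin : α • orthPart p x + β • orthPart p y = 0 := by
    have e : α * form x p + β * form y p = form p p := by
      conv_rhs => rw [hpdef, form_add_left, form_smul_left, form_smul_left, ← hpdef]
    have : α • orthPart p x + β • orthPart p y =
        p - ((α * form x p + β * form y p) / form p p) • p := by
      ext i
      simp only [orthPart, hpdef, Pi.add_apply, Pi.sub_apply, Pi.smul_apply, smul_eq_mul]
      ring
    rw [this, e, div_self hp.1.ne, one_smul, sub_self]
  have huu := form_orthPart_orthPart hp.1 hx.1
  have hvv := form_orthPart_orthPart hp.1 hy.1
  have huv := form_orthPart (x := x) (y := y) hp.1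
  rw [hdist_comm (x := y)] at hvv
  have h1 : α * form (orthPart p x) (orthPart p x) +
      β * form (orthPart p x) (orthPart p y) = 0 := by
    rw [← form_smul_right, ← form_smul_right, ← form_add_right, hlin, form_zero_right]
  have h2 : α * form (orthPart p x) (orthPart p y) +
      β * form (orthPart p y) (orthPart p y) = 0 := by
    rw [← form_smul_left, ← form_smul_left, ← form_add_left, hlin, form_zero_left]
  set U := tlen x * Real.sinh (hdist x p) with hU
  set V := tlen y * Real.sinh (hdist p y) with hV
  have hU0 : 0 ≤ U := by positivity
  have hV0 : 0 ≤ V := by positivity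
  rw [huu] at h1
  rw [hvv] at h2
  have h3 : form (orthPart p x) (orthPart p y) = -(U * V) := by
    have e1 : form (orthPart p x) (orthPart p y) = -(β / α) * V ^ 2 := by
      field_simp
      linarith
    have e2 : α * U = β * V := by
      have : (α * U) ^ 2 = (β * V) ^ 2 := by
        nlinarith
      exact (pow_left_inj₀ (by positivity) (by positivity) two_ne_zero).1 this
    rw [e1, show U = β * V / α by field_simp; linarith]
    field_simp
  rw [h3] at huv
  have e1 := abs_form_eq hx.1 hp.1
  have e2 := abs_form_eq hp.1 hy.1
  rw [abs_of_neg hxp] at e1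
  rw [abs_of_neg hpy] at e2
  have e3 : form x p * form p y / form p p =
      -(Real.cosh (hdist x p) * Real.cosh (hdist p y) * (tlen x * tlen y)) := by
    rw [show form p p = - tlen p ^ 2 by linarith [tlen_sq hp.1],
      show form x p = -(Real.cosh (hdist x p) * (tlen x * tlen p)) by linarith,
      show form p y = -(Real.cosh (hdist p y) * (tlen p * tlen y)) by linarith]
    field_simp
  rw [e3] at huv
  rw [abs_of_neg hxy]
  rw [hU, hV] at huv
  linarith

/-- Points of a segment are aligned for the hyperbolic distance. -/
theorem hdist_add_hdist (hx : IsFuture x) (hy : IsFuture y) {α β : ℝ} (hα : 0 ≤ α)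
    (hβ : 0 ≤ β) (h : 0 < α + β) :
    hdist x (α • x + β • y) + hdist (α • x + β • y) y = hdist x y := by
  rcases hα.lt_or_eq with h2 | h2
  · exact hdist_add_hdist_aux hx hy h2 hβ
  · subst h2
    have := hdist_add_hdist_aux hy hx (by linarith : 0 < β) le_rfl
    rw [hdist_comm (x := y), hdist_comm (x := y), add_comm (β • y), hdist_comm (y := x)] at this
    linarith

theorem exists_midpoint (hx : IsFuture x) (hy : IsFuture y) :
    ∃ m, IsFuture m ∧ hdist x m = hdist x y / 2 ∧ hdist m y = hdist x y / 2 := by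
  have hX := tlen_pos hx.1
  have hY := tlen_pos hy.1
  have hα : 0 < (tlen x)⁻¹ := by positivity
  have hβ : 0 < (tlen y)⁻¹ := by positivity
  have hm := hx.smul_add_smul hy hα.le hβ.le (by linarith)
  have hadd := hdist_add_hdist hx hy hα.le hβ.le (by linarith)
  refine ⟨_, hm, ?_⟩
  set m := (tlen x)⁻¹ • x + (tlen y)⁻¹ • y with hmdef
  have : hdist x m = hdist m y := by
    unfold hdist
    congr 1
    have hM := tlen_pos hm.1
    have : form x m / tlen x = form m y / tlen y := by
      rw [hmdef]
      simp only [form_add_left, form_add_right, form_smul_left, form_smul_right]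
      rw [show form x x = -tlen x ^ 2 by linarith [tlen_sq hx.1],
        show form y y = -tlen y ^ 2 by linarith [tlen_sq hy.1]]
      field_simp
      ring
    have h2 : |form x m| / tlen x = |form m y| / tlen y := by
      have := congrArg abs this
      rwa [abs_div, abs_div, abs_of_pos hX, abs_of_pos hY] at this
    rw [← div_div, h2, div_div, mul_comm (tlen y)]
  constructor <;> linarith

theorem one_add_half_sq_le_cosh {d : ℝ} (hd : 0 ≤ d) : 1 + d ^ 2 / 2 ≤ Real.cosh d := by
  have h := Real.self_le_sinh_iff.2 (by positivity : 0 ≤ d / 2)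
  have h2 := Real.cosh_two_mul (d / 2)
  rw [mul_div_cancel₀ d two_ne_zero, Real.cosh_sq] at h2
  nlinarith

/-- A linear map that dilates the time axis shortens distances: this is the infinitesimal form of
the contraction. -/
theorem cosh_hdist_map_le {N : ℕ} (T : (Fin n ⊕ Fin 1 → ℝ) → (Fin N ⊕ Fin 1 → ℝ)) {κ : ℝ}
    (hκ : 0 ≤ κ)
    (hT : ∀ x y, form (T x) (T y) = form x y - κ * (x (Sum.inr 0) * y (Sum.inr 0)))
    (hx : IsFuture x) (hy : IsFuture y) :
    Real.cosh (hdist (T x) (T y)) - 1 ≤ (1 + κ)⁻¹ * (Real.cosh (hdist x y) - 1) := by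
  have hTx : form (T x) (T x) < 0 := by
    rw [hT]; nlinarith [hx.1, mul_pos hx.2 hx.2]
  have hTy : form (T y) (T y) < 0 := by
    rw [hT]; nlinarith [hy.1, mul_pos hy.2 hy.2]
  have hX := tlen_pos hx.1
  have hY := tlen_pos hy.1
  have hTX := tlen_pos hTx
  have hTY := tlen_pos hTy
  have hxy := hx.form_neg hy
  have hle := hx.tlen_mul_tlen_le hy
  set h := x (Sum.inr 0) * y (Sum.inr 0) with hh
  have hC := abs_form_eq hx.1 hy.1
  have hC1 := Real.one_le_cosh (hdist x y)
  set C := Real.cosh (hdist x y)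
  set L := tlen x * tlen y with hL
  have hL0 : 0 < L := by positivity
  have hN : L + κ * h ≤ tlen (T x) * tlen (T y) := by
    apply le_of_sq_le_sq _ (by positivity)
    rw [mul_pow, tlen_sq hTx, tlen_sq hTy, hT, hT,
      show form x x = -tlen x ^ 2 by linarith [tlen_sq hx.1],
      show form y y = -tlen y ^ 2 by linarith [tlen_sq hy.1]]
    have : 0 ≤ κ * (tlen x * y (Sum.inr 0) - tlen y * x (Sum.inr 0)) ^ 2 := by positivity
    rw [hL, hh]
    nlinarith
  rw [cosh_hdist hTx hTy, hT, abs_of_neg (by nlinarith)]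
  rw [abs_of_neg hxy] at hC
  have hden : 0 < L + κ * h := by nlinarith
  have h1 : -(form x y - κ * h) / (tlen (T x) * tlen (T y)) ≤ (C * L + κ * h) / (L + κ * h) := by
    rw [show -(form x y - κ * h) = C * L + κ * h by linarith]
    apply div_le_div_of_nonneg_left _ hden hN
    nlinarith
  refine (sub_le_sub_right h1 1).trans ?_
  rw [div_sub_one hden.ne', inv_mul_eq_div, div_le_div_iff₀ hden (by linarith)]
  have : κ * L ≤ κ * h := mul_le_mul_of_nonneg_left hle hκ
  nlinarith

/-- A linear map that dilates the time axis contracts hyperbolic distances uniformly. The bound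
`cosh_hdist_map_le` gives this for small distances, and the general case follows by repeatedly
halving the segment. -/
theorem exists_hdist_map_le {N : ℕ} (T : (Fin n ⊕ Fin 1 → ℝ) → (Fin N ⊕ Fin 1 → ℝ)) {κ : ℝ}
    (hκ : 0 < κ)
    (hT : ∀ x y, form (T x) (T y) = form x y - κ * (x (Sum.inr 0) * y (Sum.inr 0))) :
    ∃ c : ℝ, 0 ≤ c ∧ c < 1 ∧ ∀ x y : Fin n ⊕ Fin 1 → ℝ, IsFuture x → IsFuture y →
      hdist (T x) (T y) ≤ c * hdist x y := by
  have hTf : ∀ {x}, IsFuture x → form (T x) (T x) < 0 := by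
    intro x hx
    rw [hT]; nlinarith [hx.1, mul_pos hx.2 hx.2]
  set q := (1 + κ)⁻¹ with hq
  have hq0 : 0 < q := by positivity
  have hq1 : q < 1 := inv_lt_one_of_one_lt₀ (by linarith)
  -- The error in `cosh d - 1 ≈ d ^ 2 / 2` is absorbed by replacing `q` by `(1 + q) / 2`.
  set ε := min 1 ((1 - q) / 2) with hε
  have hε0 : 0 < ε := lt_min one_pos (by linarith)
  have hε1 : ε ≤ 1 := min_le_left _ _
  have hε2 : ε ≤ (1 - q) / 2 := min_le_right _ _
  set c := √((1 + q) / 2) with hc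
  have hc2 : c ^ 2 = (1 + q) / 2 := Real.sq_sqrt (by linarith)
  have hc0 : 0 ≤ c := Real.sqrt_nonneg _
  have hbase : ∀ x y : Fin n ⊕ Fin 1 → ℝ, IsFuture x → IsFuture y → hdist x y ≤ ε →
      hdist (T x) (T y) ≤ c * hdist x y := by
    intro x y hx hy hd
    have h0 := hdist_nonneg hx.1 hy.1
    have h0' := hdist_nonneg (hTf hx) (hTf hy)
    have h1 := cosh_hdist_map_le T hκ.le hT hx hy
    have h2 : Real.cosh (hdist x y) - 1 ≤ (hdist x y) ^ 2 / 2 * (1 + ε) := by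
      have e1 := Real.cosh_le_exp_half_sq (hdist x y)
      have e2 : (hdist x y) ^ 2 / 2 ≤ ε / 2 := by nlinarith
      have e3 := Real.abs_exp_sub_one_sub_id_le (x := (hdist x y) ^ 2 / 2)
        (by rw [abs_of_nonneg (by positivity)]; linarith)
      have e4 := (abs_le.1 e3).2
      have e5 : ((hdist x y) ^ 2 / 2) ^ 2 ≤ (hdist x y) ^ 2 / 2 * ε := by
        nlinarith [sq_nonneg (hdist x y)]
      linarith
    have h3 := one_add_half_sq_le_cosh h0'
    apply le_of_sq_le_sq _ (by positivity)
    rw [mul_pow, hc2]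
    have h4 : q * (Real.cosh (hdist x y) - 1) ≤ q * ((hdist x y) ^ 2 / 2 * (1 + ε)) :=
      mul_le_mul_of_nonneg_left h2 hq0.le
    have h5 : q * (1 + ε) ≤ (1 + q) / 2 := by nlinarith
    have h6 : q * (1 + ε) * (hdist x y) ^ 2 ≤ (1 + q) / 2 * (hdist x y) ^ 2 :=
      mul_le_mul_of_nonneg_right h5 (sq_nonneg _)
    linarith
  have hind : ∀ k : ℕ, ∀ x y : Fin n ⊕ Fin 1 → ℝ, IsFuture x → IsFuture y →
      hdist x y ≤ 2 ^ k * ε → hdist (T x) (T y) ≤ c * hdist x y := by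
    intro k
    induction k with
    | zero => intro x y hx hy hd; exact hbase x y hx hy (by simpa using hd)
    | succ k ih =>
      intro x y hx hy hd
      obtain ⟨m, hm, h1, h2⟩ := exists_midpoint hx hy
      rw [pow_succ] at hd
      have e1 := ih x m hx hm (by linarith)
      have e2 := ih m y hm hy (by linarith)
      have e3 := hdist_triangle (hTf hx) (hTf hm) (hTf hy)
      rw [h1] at e1
      rw [h2] at e2
      linarith
  refine ⟨c, hc0, ?_, fun x y hx hy => ?_⟩
  · nlinarith
  · obtain ⟨k, hk⟩ := pow_unbounded_of_one_lt (hdist x y / ε) one_lt_two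
    exact hind k x y hx hy ((div_le_iff₀ hε0).1 hk.le)

end Distance

/-! ### Contraction along a reflection group -/

section Contraction

variable {I : Type*} {G : SimpleGraph I} {n N : ℕ} {v : I → Fin n ⊕ Fin 1 → ℝ}
  {v' : I → Fin N ⊕ Fin 1 → ℝ}

theorem IsRightAngledSystem.isFuture_act_rep (hv : IsRightAngledSystem G v)
    (w : (rightAngledMatrix G).Group) {x : Fin n ⊕ Fin 1 → ℝ} (hx : IsFuture x) :
    IsFuture (act (hv.rep w) x) := by
  induction w using (cox G).simple_induction_left with
  | one => simpa using hx
  | mul_simple_left w i ih =>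
    rw [map_mul, act_mul]
    refine ih.of_form_neg ?_ ?_
    · rw [form_act]; exact ih.1
    · rw [act_rep_simple, form_sub_right, form_smul_right, form_comm _ (v i)]
      nlinarith [ih.1, sq_nonneg (form (v i) (act (hv.rep w) x))]

/-- The segment from a point `x` of the chamber to a point of another chamber leaves the chamber of
`x` through a wall that separates the two chambers. -/
theorem IsRightAngledSystem.exists_exit_point [Finite I] (hv : IsRightAngledSystem G v)
    {w : (rightAngledMatrix G).Group} (hw : w ≠ 1) {x y : Fin n ⊕ Fin 1 → ℝ}
    (hx : ∀ i, form x (v i) ≤ 0) (hy : ∀ i, form y (v i) ≤ 0) :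
    ∃ i, (cox G).IsLeftDescent w i ∧ ∃ τ : ℝ, 0 ≤ τ ∧ τ ≤ 1 ∧
      form ((1 - τ) • x + τ • act (hv.rep w) y) (v i) = 0 ∧
      ∀ j, form ((1 - τ) • x + τ • act (hv.rep w) y) (v j) ≤ 0 := by
  classical
  cases nonempty_fintype I
  set q := act (hv.rep w) y with hq
  set S := Finset.univ.filter fun i => 0 < form q (v i) with hS
  rcases S.eq_empty_or_nonempty with hSe | hSn
  · obtain ⟨i, hi⟩ := (cox G).exists_leftDescent_of_ne_one hw
    have hneg : ∀ j, form q (v j) ≤ 0 := by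
      intro j
      by_contra! h
      have : j ∈ S := by simp [hS, h]
      simp [hSe] at this
    have h0 := hv.form_nonneg_of_isLeftDescent hy hi
    refine ⟨i, hi, 1, zero_le_one, le_rfl, ?_, fun j => ?_⟩
    · simpa using le_antisymm (hneg i) h0
    · simpa using hneg j
  · obtain ⟨i, hiS, hi⟩ := S.exists_min_image
      (fun i => -form x (v i) / (form q (v i) - form x (v i))) hSn
    have hpos : ∀ j ∈ S, 0 < form q (v j) := fun j hj => by simpa [hS] using hj
    have hqi := hpos i hiS
    have hden : ∀ j ∈ S, 0 < form q (v j) - form x (v j) := fun j hj => by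
      linarith [hpos j hj, hx j]
    set τ := -form x (v i) / (form q (v i) - form x (v i)) with hτ
    have hτ0 : 0 ≤ τ := div_nonneg (by linarith [hx i]) (hden i hiS).le
    have hτ1 : τ ≤ 1 := by
      rw [hτ, div_le_one (hden i hiS)]
      linarith
    refine ⟨i, hv.isLeftDescent_of_form_pos hy hqi, τ, hτ0, hτ1, ?_, fun j => ?_⟩
    · have := hden i hiS
      rw [form_add_left, form_smul_left, form_smul_left, hτ]
      field_simp
      ring
    · rw [form_add_left, form_smul_left, form_smul_left]
      by_cases hj : j ∈ S
      · have h1 := hi j hj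
        rw [le_div_iff₀ (hden j hj)] at h1
        linarith
      · have h1 : form q (v j) ≤ 0 := by
          by_contra! h
          exact hj (by simp [hS, h])
        have := mul_nonneg (sub_nonneg.2 hτ1) (neg_nonneg.2 (hx j))
        have := mul_nonneg hτ0 (neg_nonneg.2 h1)
        linarith

/-- If `T` maps the walls of the first system into those of the second and contracts distances by
the factor `c`, then its equivariant extension from the chamber to its orbit contracts distances by
`c`. -/
theorem hdist_act_rep_le [Finite I] (hv : IsRightAngledSystem G v) (hv' : IsRightAngledSystem G v')
    (T : (Fin n ⊕ Fin 1 → ℝ) → (Fin N ⊕ Fin 1 → ℝ))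
    (hTf : ∀ x, IsFuture x → form (T x) (T x) < 0)
    (hTv : ∀ x i, form x (v i) = 0 → form (T x) (v' i) = 0) {c : ℝ}
    (hT : ∀ x y, IsFuture x → IsFuture y → hdist (T x) (T y) ≤ c * hdist x y)
    (w : (rightAngledMatrix G).Group) {x y : Fin n ⊕ Fin 1 → ℝ}
    (hxf : IsFuture x) (hyf : IsFuture y)
    (hx : ∀ i, form x (v i) ≤ 0) (hy : ∀ i, form y (v i) ≤ 0) :
    hdist (T x) (act (hv'.rep w) (T y)) ≤ c * hdist x (act (hv.rep w) y) := by
  induction hm : (cox G).length w using Nat.strong_induction_on generalizing w x with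
  | _ m ih =>
  by_cases hw : w = 1
  · subst hw
    simpa using hT x y hxf hyf
  obtain ⟨i, hi, τ, hτ0, hτ1, hpi, hp⟩ := hv.exists_exit_point hw hx hy
  have hqf := hv.isFuture_act_rep w hyf
  have hpf := hxf.smul_add_smul hqf (sub_nonneg.2 hτ1) hτ0 (by linarith)
  have hadd := hdist_add_hdist hxf hqf (sub_nonneg.2 hτ1) hτ0 (by linarith)
  set p := (1 - τ) • x + τ • act (hv.rep w) y with hpdef
  have hw' : w = (cox G).simple i * ((cox G).simple i * w) :=
    ((cox G).simple_mul_simple_cancel_left i).symm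
  have h1 := ih _ (hm ▸ hi) ((cox G).simple i * w) hpf hp rfl
  -- Both sides are unchanged by the reflection in the wall `i`, which fixes `p` and `T p`.
  have h2 : hdist (T p) (act (hv'.rep ((cox G).simple i * w)) (T y)) =
      hdist (T p) (act (hv'.rep w) (T y)) := by
    conv_rhs => rw [hw', map_mul, act_mul]
    rw [← hdist_act (hv'.rep ((cox G).simple i)), hv'.act_rep_simple i (T p), form_comm,
      hTv p i hpi]
    simp
  have h3 : hdist p (act (hv.rep ((cox G).simple i * w)) y) = hdist p (act (hv.rep w) y) := by
    conv_rhs => rw [hw', map_mul, act_mul]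
    rw [← hdist_act (hv.rep ((cox G).simple i)), hv.act_rep_simple i p, form_comm, hpi]
    simp
  rw [h2, h3] at h1
  have h4 := hdist_triangle (hTf x hxf) (hTf p hpf) (y := act (hv'.rep w) (T y))
    (by rw [form_act]; exact hTf y hyf)
  have h5 := hT x p hxf hpf
  have h6 : c * hdist x (act (hv.rep w) y) = c * hdist x p + c * hdist p (act (hv.rep w) y) := by
    rw [← hadd]; ring
  linarith

end Contraction

/-! ### Proper discontinuity -/

section Proper

/-- The base point of hyperbolic space. -/
def origin (n : ℕ) : Fin n ⊕ Fin 1 → ℝ := Pi.single (Sum.inr 0) 1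

variable {n : ℕ}

theorem form_origin_left (x : Fin n ⊕ Fin 1 → ℝ) : form (origin n) x = -x (Sum.inr 0) := by
  simp [form_eq_sum, origin]

theorem form_origin_origin : form (origin n) (origin n) = -1 := by
  rw [form_origin_left]
  simp [origin]

theorem isFuture_origin : IsFuture (origin n) :=
  ⟨by rw [form_origin_origin]; norm_num, by simp [origin]⟩

theorem tlen_origin : tlen (origin n) = 1 := by simp [tlen, form_origin_origin]

theorem act_single (g : O n) (i j : Fin n ⊕ Fin 1) :
    act g (Pi.single j 1) i = (g : GL (Fin n ⊕ Fin 1) ℝ).1 i j := by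
  simp [act]

theorem sq_le_form_add_sq (x : Fin n ⊕ Fin 1 → ℝ) (i : Fin n ⊕ Fin 1) :
    x i ^ 2 ≤ max (form x x) 0 + x (Sum.inr 0) ^ 2 := by
  rcases i with i | i
  · have h := Finset.single_le_sum (f := fun i => x (Sum.inl i) ^ 2) (fun i _ => sq_nonneg _)
      (Finset.mem_univ i)
    have h2 := le_max_left (form x x) 0
    rw [form_eq_sum] at h2 ⊢
    simp only [← pow_two] at h2 ⊢
    linarith
  · rw [Subsingleton.elim i 0]
    linarith [le_max_right (form x x) 0]

/-- The entries of an element of `O(n, 1)` are bounded in terms of the distance by which it moves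
the base point. -/
theorem sq_entry_le (g : O n) (i j : Fin n ⊕ Fin 1) :
    (g : GL (Fin n ⊕ Fin 1) ℝ).1 i j ^ 2 ≤ 1 + form (origin n) (act g (origin n)) ^ 2 := by
  have hcol := sq_le_form_add_sq (act g (Pi.single j 1)) i
  have hrow := sq_le_form_add_sq (act g⁻¹ (origin n)) j
  rw [form_act, form_origin_origin, max_eq_right (by norm_num), zero_add] at hrow
  have h1 : form (Pi.single j 1 : Fin n ⊕ Fin 1 → ℝ) (Pi.single j 1) ≤ 1 := by
    rcases j with j | j
    · simp [form_eq_sum, Pi.single_apply]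
    · simp [form_eq_sum, Pi.single_apply]
      split_ifs <;> norm_num
  have h2 : act g⁻¹ (origin n) (Sum.inr 0) ^ 2 = form (origin n) (act g (origin n)) ^ 2 := by
    rw [← neg_sq, ← form_origin_left, form_comm, form_act_left, inv_inv]
  have h3 : act g (Pi.single j 1) (Sum.inr 0) ^ 2 = act g⁻¹ (origin n) j ^ 2 := by
    rw [← neg_sq, ← form_origin_left, ← inv_inv g, ← form_act_left, inv_inv]
    rcases j with j | j
    · simp [form_eq_sum, Pi.single_apply]
    · rw [Subsingleton.elim j 0]
      simp [form_eq_sum]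
  rw [act_single, form_act] at hcol
  rw [h3] at hcol
  rw [h2] at hrow
  have := max_le h1 (zero_le_one' ℝ)
  linarith

/-- The elements of `O(n, 1)` that move the base point by a bounded amount lie in a compact set. -/
theorem exists_isCompact_of_form_origin_le (R : ℝ) :
    ∃ C : Set (O n), IsCompact C ∧
      ∀ g : O n, |form (origin n) (act g (origin n))| ≤ R → g ∈ C := by
  set J := LieAlgebra.Orthogonal.indefiniteDiagonal (Fin n) (Fin 1) ℝ with hJ
  have hJJ : J * J = 1 := by
    rw [hJ, LieAlgebra.Orthogonal.indefiniteDiagonal, Matrix.diagonal_mul_diagonal,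
      ← Matrix.diagonal_one]
    congr 1
    ext i
    rcases i with i | i <;> simp
  set B := 1 + R ^ 2
  let S : Set (Matrix (Fin n ⊕ Fin 1) (Fin n ⊕ Fin 1) ℝ) :=
    {M | Mᵀ * J * M = J} ∩ Set.univ.pi fun _ => Set.univ.pi fun _ => Set.Icc (-B) B
  have hS : IsCompact S := by
    apply IsCompact.inter_left
    · exact isCompact_univ_pi fun i => isCompact_univ_pi fun j => isCompact_Icc
    · exact isClosed_eq (by fun_prop) continuous_const
  have hl : ∀ M : S, (J * M.1ᵀ * J) * M.1 = 1 := by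
    intro M
    have h : M.1ᵀ * J * M.1 = J := M.2.1
    rw [Matrix.mul_assoc J, Matrix.mul_assoc J, h, hJJ]
  have hr : ∀ M : S, M.1 * (J * M.1ᵀ * J) = 1 := fun M => mul_eq_one_comm.1 (hl M)
  let f : S → O n := fun M => ⟨⟨M.1, J * M.1ᵀ * J, hr M, hl M⟩, M.2.1⟩
  have hf : Continuous f := by
    refine Continuous.subtype_mk (Units.continuous_iff.2 ⟨continuous_subtype_val, ?_⟩) _
    change Continuous fun M : S => J * M.1ᵀ * J
    fun_prop
  have : CompactSpace S := isCompact_iff_compactSpace.1 hS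
  refine ⟨Set.range f, isCompact_range hf, fun g hg => ?_⟩
  refine ⟨⟨g.1.1, g.2, ?_⟩, Subtype.ext (Units.ext rfl)⟩
  intro i _ j _
  have h1 := sq_entry_le g i j
  have h2 : form (origin n) (act g (origin n)) ^ 2 ≤ R ^ 2 :=
    sq_le_sq' (abs_le.1 hg).1 (abs_le.1 hg).2
  have h3 : 1 ≤ B := by
    have := sq_nonneg R
    simp only [B]; linarith
  exact abs_le.1 (abs_le_of_sq_le_sq (by nlinarith) (by linarith))

theorem continuous_hdist_act {x y : Fin n ⊕ Fin 1 → ℝ} (hx : form x x < 0) (hy : form y y < 0) :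
    Continuous fun g : O n => hdist (act g x) y := by
  unfold hdist
  refine Real.continuousOn_arcosh.comp_continuous ?_ fun g =>
    one_le_of_timelike (by rwa [form_act]) hy
  have : ∀ g : O n, tlen (act g x) = tlen x := fun g => by rw [tlen, form_act, tlen]
  simp only [this]
  exact (continuous_form_act x y).abs.div_const _

/-- A representation `ρ'` whose displacement of some point is at most a definite fraction of that of
the faithful discrete representation `ρ`, up to an additive constant, makes the action by
right-and-left multiplication properly discontinuous. -/
theorem actsProperlyDiscontinuously_of_contraction {Γ : Type*} [Group Γ] {ρ ρ' : Γ →* O n}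
    (hρ : IsFaithfulDiscrete ρ) {p : Fin n ⊕ Fin 1 → ℝ} (hp : form p p < 0) {c : ℝ} (hc : c < 1)
    (h : ∀ γ, hdist p (act (ρ' γ) p) ≤ c * hdist (origin n) (act (ρ γ) (origin n))) :
    ActsProperlyDiscontinuously ρ ρ' := by
  have ho : form (origin n) (origin n) < 0 := isFuture_origin.1
  refine @ProperlyDiscontinuousSMul.mk _ _ _ (rightLeftAction ρ ρ').toSMul ?_
  intro K L hK hL
  obtain ⟨A, hA⟩ := hK.exists_bound_of_continuousOn (continuous_hdist_act ho hp).continuousOn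
  obtain ⟨B, hB⟩ := hL.exists_bound_of_continuousOn (continuous_hdist_act ho hp).continuousOn
  obtain ⟨C, hC, hCmem⟩ := exists_isCompact_of_form_origin_le (n := n)
    (Real.cosh ((A + B) / (1 - c)))
  have hdisc := hρ.2
  have hfin : ((ρ.range : Set (O n)) ∩ C).Finite := by
    have hclosed : IsClosed (ρ.range : Set (O n)) := Subgroup.isClosed_of_discrete
    refine (hC.inter_left hclosed).finite ?_
    exact (DiscreteTopology.isDiscrete (s := (ρ.range : Set (O n)))).mono Set.inter_subset_left
  refine (hfin.preimage hρ.1.injOn).subset ?_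
  rintro γ hγ
  obtain ⟨l, ⟨k, hk, hkl⟩, hl⟩ := hγ
  refine ⟨⟨γ, rfl⟩, hCmem _ ?_⟩
  have hkl : ρ' γ * k * (ρ γ)⁻¹ = l := hkl
  have hkl : l * ρ γ = ρ' γ * k := by rw [← hkl]; group
  set d := hdist (origin n) (act (ρ γ) (origin n)) with hd
  have h1 : d = hdist (act l (origin n)) (act (ρ' γ) (act k (origin n))) := by
    rw [hd, ← hdist_act l, ← act_mul, hkl, act_mul]
  have h2 := hdist_triangle (x := act l (origin n)) (p := p)
    (y := act (ρ' γ) (act k (origin n))) (by rwa [form_act]) hp (by rwa [form_act, form_act])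
  have h3 := hdist_triangle (x := p) (p := act (ρ' γ) p)
    (y := act (ρ' γ) (act k (origin n))) hp (by rwa [form_act]) (by rwa [form_act, form_act])
  rw [hdist_act, hdist_comm (x := p) (y := act k _)] at h3
  have h4 := (abs_le.1 (hA k hk)).2
  have h5 := (abs_le.1 (hB l hl)).2
  have h6 : d ≤ (A + B) / (1 - c) := by
    rw [le_div_iff₀ (by linarith)]
    have := h γ
    linarith
  have h7 := abs_form_eq (x := origin n) (y := act (ρ γ) (origin n)) ho (by rwa [form_act])
  have h8 : tlen (act (ρ γ) (origin n)) = 1 := by rw [tlen, form_act, ← tlen, tlen_origin]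
  rw [tlen_origin, h8, mul_one, mul_one] at h7
  rw [h7, Real.cosh_le_cosh, abs_of_nonneg (hdist_nonneg ho (by rwa [form_act]))]
  exact h6.trans (le_abs_self _)

end Proper

/-! ### Deforming a coloured reflection group -/

section Deformation

open Filter Topology

/-- The vertices of a regular simplex of `ℝᵐ` centered at the origin. -/
theorem exists_regular_simplex (m : ℕ) : ∃ e : Fin (m + 1) → Fin m → ℝ,
    ∀ a b, e a ⬝ᵥ e b = (if a = b then 1 else 0) - 1 / (m + 1 : ℝ) := by
  set s := √(m + 1 : ℝ) with hs
  have hs2 : s ^ 2 = m + 1 := Real.sq_sqrt (by positivity)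
  have hs0 : 0 < s := Real.sqrt_pos.2 (by positivity)
  set β := (1 - 1 / s) / m with hβ
  refine ⟨Fin.lastCases (fun _ => -(1 / s)) (fun i => Pi.single i 1 - fun _ => β), ?_⟩
  rw [← hs2]
  have hone : ∀ x y : ℝ, (fun _ : Fin m => x) ⬝ᵥ (fun _ => y) = m * (x * y) := by
    intro x y; simp [dotProduct]
  intro a b
  refine Fin.lastCases ?_ (fun i => ?_) a <;> refine Fin.lastCases ?_ (fun j => ?_) b
  · simp only [Fin.lastCases_last, hone, if_true]
    field_simp
    linarith
  · have hm : (m : ℝ) ≠ 0 := by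
      have := j.pos; positivity
    simp only [Fin.lastCases_last, Fin.lastCases_castSucc, dotProduct_sub, hone,
      dotProduct_single, (Fin.castSucc_lt_last j).ne', if_false]
    rw [hβ]
    field_simp
    ring
  · have hm : (m : ℝ) ≠ 0 := by
      have := i.pos; positivity
    simp only [Fin.lastCases_last, Fin.lastCases_castSucc, sub_dotProduct, hone,
      single_dotProduct, (Fin.castSucc_lt_last i).ne, if_false]
    rw [hβ]
    field_simp
    ring
  · have hm : (m : ℝ) ≠ 0 := by
      have := i.pos; positivity
    have h1 : (m : ℝ) = s ^ 2 - 1 := by linarith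
    simp only [Fin.lastCases_castSucc, sub_dotProduct, dotProduct_sub, hone, single_dotProduct,
      dotProduct_single, Fin.castSucc_inj, Pi.sub_apply]
    have h2 : (m : ℝ) * (β * β) = 2 * β - 1 / s ^ 2 := by
      rw [hβ]
      field_simp
      rw [h1]
      ring
    rw [h2]
    by_cases hij : i = j
    · subst hij
      simp only [Pi.single_eq_same, if_true]
      ring
    · simp only [Pi.single_eq_of_ne' hij, hij, if_false]
      ring

variable {n m : ℕ}

/-- The vector of `ℝ^{n+m,1}` with space coordinates `x` and `y` and time coordinate `a`. -/
def extend (x : Fin n → ℝ) (y : Fin m → ℝ) (a : ℝ) : Fin (n + m) ⊕ Fin 1 → ℝ :=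
  Sum.elim (Fin.append x y) fun _ => a

theorem form_extend (x x' : Fin n → ℝ) (y y' : Fin m → ℝ) (a a' : ℝ) :
    form (extend x y a) (extend x' y' a') = x ⬝ᵥ x' + y ⬝ᵥ y' - a * a' := by
  simp [form_eq_sum, extend, Fin.sum_univ_add, dotProduct]

theorem form_eq_dotProduct (x y : Fin n ⊕ Fin 1 → ℝ) :
    form x y = (fun i => x (Sum.inl i)) ⬝ᵥ (fun i => y (Sum.inl i)) -
      x (Sum.inr 0) * y (Sum.inr 0) :=
  form_eq_sum x y

/-- The standard embedding of `ℝ^{n,1}` into `ℝ^{n+m,1}`, followed by the dilation of the time axis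
by the factor `a`. -/
def dilate (m : ℕ) (a : ℝ) (x : Fin n ⊕ Fin 1 → ℝ) : Fin (n + m) ⊕ Fin 1 → ℝ :=
  extend (fun i => x (Sum.inl i)) 0 (a * x (Sum.inr 0))

theorem form_dilate (a : ℝ) (x y : Fin n ⊕ Fin 1 → ℝ) :
    form (dilate m a x) (dilate m a y) =
      form x y - (a ^ 2 - 1) * (x (Sum.inr 0) * y (Sum.inr 0)) := by
  rw [dilate, dilate, form_extend, form_eq_dotProduct]
  simp
  ring

theorem form_dilate_one (x y : Fin n ⊕ Fin 1 → ℝ) :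
    form (dilate m 1 x) (dilate m 1 y) = form x y := by
  rw [form_dilate]; ring

theorem dilate_one_sub_smul (x y : Fin n ⊕ Fin 1 → ℝ) (a : ℝ) :
    dilate m 1 (x - a • y) = dilate m 1 x - a • dilate m 1 y := by
  ext i
  rcases i with i | i
  · refine Fin.addCases (fun j => ?_) (fun j => ?_) i <;> simp [dilate, extend]
  · simp [dilate, extend]

theorem dilate_one_origin : dilate m 1 (origin n) = origin (n + m) := by
  ext i
  rcases i with i | i
  · refine Fin.addCases (fun j => ?_) (fun j => ?_) i <;> simp [dilate, extend, origin]
  · simp [dilate, extend, origin, Subsingleton.elim i 0]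

variable {I : Type*} {G : SimpleGraph I} {v : I → Fin n ⊕ Fin 1 → ℝ}

theorem IsRightAngledSystem.dilate_one (hv : IsRightAngledSystem G v) :
    IsRightAngledSystem G fun i => dilate m 1 (v i) where
  unit i := by rw [form_dilate_one]; exact hv.unit i
  adj i j h := by rw [form_dilate_one]; exact hv.adj i j h
  not_adj i j h h' := by rw [form_dilate_one]; exact hv.not_adj i j h h'

theorem act_rep_dilate_one (hv : IsRightAngledSystem G v) (w : (rightAngledMatrix G).Group)
    (x : Fin n ⊕ Fin 1 → ℝ) :
    act ((hv.dilate_one (m := m)).rep w) (dilate m 1 x) = dilate m 1 (act (hv.rep w) x) := by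
  induction w using (cox G).simple_induction_left with
  | one => simp
  | mul_simple_left w i ih =>
    rw [map_mul, act_mul, ih, map_mul, act_mul, IsRightAngledSystem.act_rep_simple,
      hv.act_rep_simple, form_dilate_one, dilate_one_sub_smul]

/-- Bending along a colouring: the `a`-th colour is given its own new direction `e a`, and the time
axis is shrunk by the factor `σ` to compensate for the negative products of the directions `e a`. -/
def bend (t σ : ℝ) (e : Fin (m + 1) → Fin m → ℝ) (col : I → Fin (m + 1))
    (v : I → Fin n ⊕ Fin 1 → ℝ) (i : I) : Fin (n + m) ⊕ Fin 1 → ℝ :=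
  extend (fun j => v i (Sum.inl j)) ((t * v i (Sum.inr 0)) • e (col i)) (σ * v i (Sum.inr 0))

theorem form_dilate_bend (t : ℝ) {σ : ℝ} (hσ : σ ≠ 0) (e : Fin (m + 1) → Fin m → ℝ)
    (col : I → Fin (m + 1)) (x : Fin n ⊕ Fin 1 → ℝ) (i : I) :
    form (dilate m σ⁻¹ x) (bend t σ e col v i) = form x (v i) := by
  rw [dilate, bend, form_extend, form_eq_dotProduct]
  field_simp
  simp

theorem form_bend {t σ : ℝ} (hσ : σ ^ 2 = 1 - t ^ 2 / (m + 1)) {e : Fin (m + 1) → Fin m → ℝ}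
    (he : ∀ a b, e a ⬝ᵥ e b = (if a = b then 1 else 0) - 1 / (m + 1 : ℝ))
    (col : I → Fin (m + 1)) (i j : I) :
    form (bend t σ e col v i) (bend t σ e col v j) = form (v i) (v j) +
      t ^ 2 * (v i (Sum.inr 0) * v j (Sum.inr 0)) * (if col i = col j then 1 else 0) := by
  rw [bend, bend, form_extend, form_eq_dotProduct, smul_dotProduct, dotProduct_smul, he]
  simp only [smul_eq_mul]
  rw [show σ * v i (Sum.inr 0) * (σ * v j (Sum.inr 0)) =
    σ ^ 2 * (v i (Sum.inr 0) * v j (Sum.inr 0)) by ring, hσ]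
  ring

/-- For small `t`, bending keeps the hyperplanes of nonadjacent vectors disjoint. -/
theorem exists_bending_parameter [Finite I]
    (hv : ∀ i j, i ≠ j → ¬ G.Adj i j → form (v i) (v j) < -1) (col : I → Fin (m + 1)) :
    ∃ t : ℝ, 0 < t ∧ t ^ 2 / (m + 1) < 1 ∧ ∀ i j, i ≠ j → ¬ G.Adj i j →
      form (v i) (v j) +
        t ^ 2 * (v i (Sum.inr 0) * v j (Sum.inr 0)) * (if col i = col j then 1 else 0) <
      -(√(1 + t ^ 2 * v i (Sum.inr 0) ^ 2) * √(1 + t ^ 2 * v j (Sum.inr 0) ^ 2)) := by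
  have h1 : ∀ᶠ t in 𝓝[>] (0 : ℝ), t ^ 2 / (m + 1 : ℝ) < 1 := by
    have hc : Continuous fun t : ℝ => t ^ 2 / (m + 1 : ℝ) := by fun_prop
    exact (hc.tendsto 0).mono_left nhdsWithin_le_nhds |>.eventually_lt_const (by simp)
  have h2 : ∀ᶠ t in 𝓝[>] (0 : ℝ), ∀ i j, i ≠ j → ¬ G.Adj i j →
      form (v i) (v j) +
        t ^ 2 * (v i (Sum.inr 0) * v j (Sum.inr 0)) * (if col i = col j then 1 else 0) <
      -(√(1 + t ^ 2 * v i (Sum.inr 0) ^ 2) * √(1 + t ^ 2 * v j (Sum.inr 0) ^ 2)) := by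
    rw [eventually_all]
    intro i
    rw [eventually_all]
    intro j
    by_cases hij : i = j
    · exact Eventually.of_forall fun t h => absurd hij h
    by_cases hadj : G.Adj i j
    · exact Eventually.of_forall fun t _ h => absurd hadj h
    refine (Eventually.mono ?_ fun t ht _ _ => ht)
    refine Filter.Tendsto.eventually_lt
      ((Continuous.tendsto (by fun_prop) 0).mono_left nhdsWithin_le_nhds)
      ((Continuous.tendsto (by fun_prop) 0).mono_left nhdsWithin_le_nhds) ?_
    simpa using hv i j hij hadj
  have h0 : ∀ᶠ t in 𝓝[>] (0 : ℝ), t ∈ Set.Ioi 0 := self_mem_nhdsWithin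
  obtain ⟨t, ht0, ht1, ht2⟩ := (h0.and (h1.and h2)).exists
  exact ⟨t, ht0, ht1, ht2⟩

theorem sqrt_one_add_sq_pos (t : ℝ) (i : I) : 0 < √(1 + t ^ 2 * v i (Sum.inr 0) ^ 2) :=
  Real.sqrt_pos.2 (by positivity)

theorem isRightAngledSystem_bend (hv : IsRightAngledSystem G v)
    {col : I → Fin (m + 1)} (hcol : ∀ i j, G.Adj i j → col i ≠ col j)
    {t σ : ℝ} (hσ : σ ^ 2 = 1 - t ^ 2 / (m + 1)) {e : Fin (m + 1) → Fin m → ℝ}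
    (he : ∀ a b, e a ⬝ᵥ e b = (if a = b then 1 else 0) - 1 / (m + 1 : ℝ))
    (ht : ∀ i j, i ≠ j → ¬ G.Adj i j →
      form (v i) (v j) +
        t ^ 2 * (v i (Sum.inr 0) * v j (Sum.inr 0)) * (if col i = col j then 1 else 0) <
      -(√(1 + t ^ 2 * v i (Sum.inr 0) ^ 2) * √(1 + t ^ 2 * v j (Sum.inr 0) ^ 2))) :
    IsRightAngledSystem G fun i =>
      (√(1 + t ^ 2 * v i (Sum.inr 0) ^ 2))⁻¹ • bend t σ e col v i where
  unit i := by
    have h : √(1 + t ^ 2 * v i (Sum.inr 0) ^ 2) ^ 2 = 1 + t ^ 2 * v i (Sum.inr 0) ^ 2 :=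
      Real.sq_sqrt (by positivity)
    have h0 := sqrt_one_add_sq_pos (v := v) t i
    rw [form_smul_left, form_smul_right, form_bend hσ he, hv.unit, if_pos rfl]
    field_simp
    rw [h]
  adj i j h := by
    rw [form_smul_left, form_smul_right, form_bend hσ he, hv.adj i j h, if_neg (hcol i j h)]
    simp
  not_adj i j h h' := by
    have h0 := sqrt_one_add_sq_pos (v := v) t i
    have h1 := sqrt_one_add_sq_pos (v := v) t j
    rw [form_smul_left, form_smul_right, form_bend hσ he, ← mul_assoc, ← _root_.mul_inv,
      inv_mul_eq_div, div_le_iff₀ (by positivity)]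
    linarith [ht i j h h']

/-- Bending the walls of a right-angled reflection group along a colouring, by a small amount,
contracts the group: the original representation, put into `O(n + m, 1)`, and the bent one act
properly discontinuously on `O(n + m, 1)` by right-and-left multiplication. -/
theorem exists_proper_pair_of_time_pos [Finite I] (hv : IsRightAngledSystem G v)
    (hv1 : ∀ i j, i ≠ j → ¬ G.Adj i j → form (v i) (v j) < -1)
    (hpos : ∀ i, 0 < v i (Sum.inr 0))
    {col : I → Fin (m + 1)} (hcol : ∀ i j, G.Adj i j → col i ≠ col j)
    {Γ : Type*} [Group Γ] (f : Γ ≃* (rightAngledMatrix G).Group) :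
    ∃ ρ ρ' : Γ →* O (n + m), IsFaithfulDiscrete ρ ∧ IsFaithfulDiscrete ρ' ∧
      ActsProperlyDiscontinuously ρ ρ' := by
  obtain ⟨e, he⟩ := exists_regular_simplex m
  obtain ⟨t, ht0, ht1, ht⟩ := exists_bending_parameter hv1 col
  set σ := √(1 - t ^ 2 / (m + 1)) with hσdef
  have hσ : σ ^ 2 = 1 - t ^ 2 / (m + 1) := Real.sq_sqrt (by linarith)
  have hσ0 : 0 < σ := Real.sqrt_pos.2 (by linarith)
  have hv' := isRightAngledSystem_bend hv hcol hσ he ht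
  have hfd : ∀ {ρ : (rightAngledMatrix G).Group →* O (n + m)}, IsFaithfulDiscrete ρ →
      IsFaithfulDiscrete (ρ.comp f.toMonoidHom) := by
    intro ρ hρ
    refine ⟨hρ.1.comp f.injective, ?_⟩
    have : (ρ.comp f.toMonoidHom).range = ρ.range := by
      rw [MonoidHom.range_comp, MonoidHom.range_eq_top.2 f.surjective, ← MonoidHom.range_eq_map]
    rw [this]
    exact hρ.2
  have ho : ∀ i, form (origin n) (v i) < 0 := fun i => by
    rw [form_origin_left]; linarith [hpos i]
  have h1 : IsFaithfulDiscrete (hv.dilate_one (m := m)).rep := by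
    apply IsRightAngledSystem.isFaithfulDiscrete_rep (p := dilate m 1 (origin n))
    intro i
    rw [form_dilate_one]
    exact ho i
  have hTv : ∀ x i, form (dilate m σ⁻¹ x)
      ((√(1 + t ^ 2 * v i (Sum.inr 0) ^ 2))⁻¹ • bend t σ e col v i) =
      (√(1 + t ^ 2 * v i (Sum.inr 0) ^ 2))⁻¹ * form x (v i) := by
    intro x i
    rw [form_smul_right, form_dilate_bend t hσ0.ne']
  have h2 : IsFaithfulDiscrete hv'.rep := by
    apply IsRightAngledSystem.isFaithfulDiscrete_rep (p := dilate m σ⁻¹ (origin n))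
    intro i
    rw [hTv]
    have := sqrt_one_add_sq_pos (v := v) t i
    exact mul_neg_of_pos_of_neg (by positivity) (ho i)
  have hκ : 0 < σ⁻¹ ^ 2 - 1 := by
    have : 0 < t ^ 2 / (m + 1) := by positivity
    rw [inv_pow, hσ, sub_pos]
    exact one_lt_inv_iff₀.2 ⟨by linarith, by linarith⟩
  have hTf : ∀ x : Fin n ⊕ Fin 1 → ℝ, IsFuture x →
      form (dilate m σ⁻¹ x) (dilate m σ⁻¹ x) < 0 := by
    intro x hx
    rw [form_dilate]
    nlinarith [hx.1, mul_pos hx.2 hx.2]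
  obtain ⟨c, -, hc1, hc⟩ := exists_hdist_map_le (dilate (n := n) m σ⁻¹) hκ (form_dilate _)
  refine ⟨_, _, hfd h1, hfd h2, actsProperlyDiscontinuously_of_contraction (hfd h1)
    (hTf _ isFuture_origin) hc1 fun γ => ?_⟩
  have key := hdist_act_rep_le hv hv' (dilate m σ⁻¹) hTf
    (fun x i hx => by rw [hTv, hx, mul_zero]) hc (f γ) isFuture_origin isFuture_origin
    (fun i => (ho i).le) (fun i => (ho i).le)
  have hbase : hdist (origin (n + m)) (act ((hv.dilate_one (m := m)).rep (f γ)) (origin (n + m))) =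
      hdist (origin n) (act (hv.rep (f γ)) (origin n)) := by
    rw [← dilate_one_origin, act_rep_dilate_one hv]
    simp only [hdist, tlen, form_dilate_one]
  change hdist _ (act (hv'.rep (f γ)) _) ≤ c * hdist _ (act ((hv.dilate_one (m := m)).rep (f γ)) _)
  rw [hbase]
  exact key

/-- The main construction, for a reflection group given by the unit normals `u i` of its walls and
an interior point `x₀` of its chamber. -/
theorem exists_proper_pair [Finite I] {u : I → Fin n ⊕ Fin 1 → ℝ}
    (hunit : ∀ i, form (u i) (u i) = 1)
    (hu : ∀ i j, i ≠ j → form (u i) (u j) = 0 ∨ form (u i) (u j) < -1)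
    {x₀ : Fin n ⊕ Fin 1 → ℝ} (hx₀ : IsFuture x₀) (hint : ∀ i, form x₀ (u i) < 0)
    {col : I → Fin (m + 1)} (hcol : ∀ i j, form (u i) (u j) = 0 → col i ≠ col j) :
    ∃ ρ ρ' : Subgroup.closure (Set.range fun i => reflection (u i)) →* O (n + m),
      IsFaithfulDiscrete ρ ∧ IsFaithfulDiscrete ρ' ∧ ActsProperlyDiscontinuously ρ ρ' := by
  let G : SimpleGraph I :=
    { Adj := fun i j => form (u i) (u j) = 0
      symm := ⟨fun i j h => by rw [form_comm]; exact h⟩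
      loopless := ⟨fun i h => by rw [hunit] at h; exact one_ne_zero h⟩ }
  have hlt : ∀ i j, i ≠ j → ¬ G.Adj i j → form (u i) (u j) < -1 :=
    fun i j hij h => (hu i j hij).resolve_left h
  have hsys : IsRightAngledSystem G u :=
    ⟨hunit, fun i j h => h, fun i j hij h => (hlt i j hij h).le⟩
  let f : Subgroup.closure (Set.range fun i => reflection (u i)) ≃* (rightAngledMatrix G).Group :=
    (MulEquiv.subgroupCongr hsys.range_rep.symm).trans
      (MonoidHom.ofInjective (hsys.rep_injective hint)).symm
  -- The reflection in the timelike vector `x₁ + origin`, where `x₁` is the normalization of `x₀`,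
  -- maps `x₁` to `-origin`.
  have hL := tlen_pos hx₀.1
  set x₁ := (tlen x₀)⁻¹ • x₀ with hx₁
  have hx₁x₁ : form x₁ x₁ = -1 := by
    rw [hx₁, form_smul_left, form_smul_right,
      show form x₀ x₀ = -tlen x₀ ^ 2 by linarith [tlen_sq hx₀.1]]
    field_simp
  have hx₁0 : 0 < x₁ (Sum.inr 0) := by
    rw [hx₁, Pi.smul_apply, smul_eq_mul]
    exact mul_pos (by positivity) hx₀.2
  have hg : act (reflection (x₁ + origin n)) x₁ = -origin n := by
    have h1 : form x₁ (origin n) = -x₁ (Sum.inr 0) := by rw [form_comm, form_origin_left]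
    have h2 : form (x₁ + origin n) x₁ = -1 - x₁ (Sum.inr 0) := by
      rw [form_add_left, hx₁x₁, form_origin_left]; ring
    have h3 : form (x₁ + origin n) (x₁ + origin n) = 2 * (-1 - x₁ (Sum.inr 0)) := by
      rw [form_add_right, h2, form_add_left, h1, form_origin_origin]; ring
    rw [act_reflection, h2, h3, div_self (by linarith), one_smul]
    abel
  set g := reflection (x₁ + origin n)
  set v : I → Fin n ⊕ Fin 1 → ℝ := fun i => -act g (u i) with hvdef
  have hform : ∀ i j, form (v i) (v j) = form (u i) (u j) := by
    intro i j
    rw [hvdef, form_neg_left, form_neg_right, neg_neg, form_act]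
  have hv : IsRightAngledSystem G v :=
    ⟨fun i => (hform i i).trans (hunit i), fun i j h => (hform i j).trans h,
      fun i j hij h => (hform i j).trans_le (hlt i j hij h).le⟩
  refine exists_proper_pair_of_time_pos hv
    (fun i j hij h => (hform i j).trans_lt (hlt i j hij h)) (fun i => ?_) hcol f
  have h1 : form (origin n) (v i) < 0 := by
    rw [hvdef, form_neg_right, ← form_neg_left, ← hg, form_act, hx₁, form_smul_left]
    exact mul_neg_of_pos_of_neg (by positivity) (hint i)
  rw [form_origin_left] at h1
  linarith

end Deformation

/-! ### Right-angled polygons -/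

namespace ConvexPolygon

variable {k : ℕ} (P : ConvexPolygon k)

theorem isFuture_vertex (i : ZMod k) : IsFuture (P.vertex i) :=
  ⟨by rw [(P.vertex_mem i).1]; norm_num, (P.vertex_mem i).2⟩

theorem form_vertex_normal_nonpos (i j : ZMod k) : form (P.vertex j) (P.normal i) ≤ 0 := by
  by_cases h : j = i
  · rw [h]; exact (P.normal_left i).le
  by_cases h' : j = i + 1
  · rw [h']; exact (P.normal_right i).le
  exact (P.strictly_inside i j h h').le

theorem natCast_ne_zero {a : ℕ} (ha : 0 < a) (hak : a < k) : (a : ZMod k) ≠ 0 := by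
  rw [Ne, ZMod.natCast_eq_zero_iff]
  exact Nat.not_dvd_of_pos_of_lt ha hak

/-- A vector orthogonal to an orthonormal frame `p, n, n'` of `ℝ^{2,1}` vanishes. -/
theorem eq_zero_of_orthogonal_frame {p n n' y : Fin 2 ⊕ Fin 1 → ℝ} (hp : form p p = -1)
    (hn : form n n = 1) (hn' : form n' n' = 1) (hpn : form p n = 0) (hpn' : form p n' = 0)
    (hnn' : form n n' = 0) (hy : form p y = 0) (hy' : form n y = 0) (hy'' : form n' y = 0) :
    y = 0 := by
  set J := LieAlgebra.Orthogonal.indefiniteDiagonal (Fin 2) (Fin 1) ℝ with hJ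
  have hdetJ : J.det ≠ 0 := by
    rw [hJ, LieAlgebra.Orthogonal.indefiniteDiagonal, Matrix.det_diagonal]
    simp [Fintype.prod_sum_type]
  let R : Fin 2 ⊕ Fin 1 → Fin 2 ⊕ Fin 1 → ℝ := Sum.elim ![n, n'] fun _ => p
  let A : Matrix (Fin 2 ⊕ Fin 1) (Fin 2 ⊕ Fin 1) ℝ := Matrix.of R
  have hA : A * J * Aᵀ = J := by
    have h : ∀ i j, (A * J * Aᵀ) i j = form (R i) (R j) := by
      intro i j
      rw [Matrix.mul_assoc, Matrix.mul_apply']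
      unfold form
      congr 1
    ext i j
    rw [h]
    have hnp := (form_comm n p).trans hpn
    have hnp' := (form_comm n' p).trans hpn'
    have hnn := (form_comm n' n).trans hnn'
    rcases i with i | i <;> rcases j with j | j
    · fin_cases i <;> fin_cases j <;>
        simp [R, hJ, LieAlgebra.Orthogonal.indefiniteDiagonal, hn, hn', hnn', hnn]
    · fin_cases i <;> simp [R, hJ, LieAlgebra.Orthogonal.indefiniteDiagonal, hnp, hnp']
    · fin_cases j <;> simp [R, hJ, LieAlgebra.Orthogonal.indefiniteDiagonal, hpn, hpn']
    · simp [R, hJ, LieAlgebra.Orthogonal.indefiniteDiagonal, hp, Subsingleton.elim i 0,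
        Subsingleton.elim j 0]
  have hdetA : A.det ≠ 0 := by
    intro h
    apply hdetJ
    rw [← hA, Matrix.det_mul, Matrix.det_mul, h, zero_mul, zero_mul]
  have hJy : J *ᵥ y = 0 := by
    apply Matrix.eq_zero_of_mulVec_eq_zero hdetA
    ext i
    rcases i with i | i
    · fin_cases i
      · exact hy'
      · exact hy''
    · exact hy
  exact Matrix.eq_zero_of_mulVec_eq_zero hdetJ hJy

variable {P}

/-- In a right-angled polygon, the orthogonal projection to the line of a side maps the polygon to
that side, as the two neighbouring sides lie on perpendiculars to that line. -/
theorem IsRightAngled.exists_projection_eq (hP : P.IsRightAngled) (hk : 6 ≤ k) (b : ZMod k)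
    {x : Fin 2 ⊕ Fin 1 → ℝ} (hx : ∀ i, form x (P.normal i) ≤ 0) :
    ∃ α β : ℝ, 0 ≤ α ∧ 0 ≤ β ∧ x - form x (P.normal b) • P.normal b =
      α • P.vertex b + β • P.vertex (b + 1) := by
  have h1 : (1 : ZMod k) ≠ 0 := by simpa using natCast_ne_zero (k := k) one_pos (by omega)
  have h2 : (2 : ZMod k) ≠ 0 := by simpa using natCast_ne_zero (k := k) two_pos (by omega)
  have hA : form (P.vertex b) (P.normal (b + 1)) < 0 := by
    apply P.strictly_inside
    · intro h; apply h1; linear_combination -h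
    · intro h; apply h2; linear_combination -h
  have hB : form (P.vertex (b + 1)) (P.normal (b - 1)) < 0 := by
    apply P.strictly_inside
    · intro h; apply h2; linear_combination h
    · intro h; apply h1; linear_combination h
  have hb : form (P.normal b) (P.normal (b + 1)) = 0 := hP b
  have hb' : form (P.normal b) (P.normal (b - 1)) = 0 := by
    have := hP (b - 1)
    rwa [sub_add_cancel, form_comm] at this
  have hl := P.normal_left b
  have hr := P.normal_right b
  have hl1 := P.normal_left (b + 1)
  have hr1 := P.normal_right (b - 1)
  rw [sub_add_cancel] at hr1
  have hun := P.normal_unit b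
  have hup := (P.vertex_mem (b + 1)).1
  set α := form x (P.normal (b + 1)) / form (P.vertex b) (P.normal (b + 1)) with hα
  set β := form x (P.normal (b - 1)) / form (P.vertex (b + 1)) (P.normal (b - 1)) with hβ
  refine ⟨α, β, div_nonneg_of_nonpos (hx _) hA.le, div_nonneg_of_nonpos (hx _) hB.le, ?_⟩
  set y := x - form x (P.normal b) • P.normal b - (α • P.vertex b + β • P.vertex (b + 1)) with hy
  have hy0 : form y (P.normal b) = 0 := by
    simp only [hy, form_sub_left, form_add_left, form_smul_left, hun, hl, hr]
    ring
  have hyp : form y (P.normal (b + 1)) = 0 := by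
    simp only [hy, form_sub_left, form_add_left, form_smul_left, hb, hl1]
    rw [hα, div_mul_cancel₀ _ hA.ne]
    ring
  have hym : form y (P.normal (b - 1)) = 0 := by
    simp only [hy, form_sub_left, form_add_left, form_smul_left, hb', hr1]
    rw [hβ, div_mul_cancel₀ _ hB.ne]
    ring
  -- `y` is orthogonal to the normals `b` and `b + 1`, hence a multiple of the vertex `b + 1`.
  have hyv : y + form y (P.vertex (b + 1)) • P.vertex (b + 1) = 0 := by
    apply eq_zero_of_orthogonal_frame hup hun (P.normal_unit (b + 1)) hr hl1 hb
    · rw [form_add_right, form_smul_right, hup, form_comm]; ring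
    · rw [form_add_right, form_smul_right, form_comm _ y, hy0, form_comm (P.normal b), hr]; ring
    · rw [form_add_right, form_smul_right, form_comm _ y, hyp, form_comm (P.normal (b + 1)), hl1]
      ring
  have h3 : form y (P.vertex (b + 1)) = 0 := by
    have := congrArg (fun z => form z (P.normal (b - 1))) hyv
    simp only [form_add_left, form_smul_left, form_zero_left, hym, zero_add] at this
    exact (mul_eq_zero.1 this).resolve_right hB.ne
  rw [h3, zero_smul, add_zero] at hyv
  exact sub_eq_zero.1 hyv

/-- Two nonadjacent sides of a right-angled polygon lie on lines at positive distance. If they did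
not, alternating projections between the two sides would lead to points of the first side at
arbitrarily small distance from the line of the second one, whereas these two are disjoint and the
first side is compact. -/
theorem IsRightAngled.form_normal_lt (hP : P.IsRightAngled) (hk : 6 ≤ k) {a b : ZMod k}
    (hab : b ≠ a) (hab1 : b ≠ a + 1) (hba1 : a ≠ b + 1) :
    form (P.normal a) (P.normal b) < -1 := by
  have in1 : form (P.vertex b) (P.normal a) < 0 := P.strictly_inside a b hab hab1
  have in2 : form (P.vertex (b + 1)) (P.normal a) < 0 :=
    P.strictly_inside a (b + 1) hba1.symm (fun h => hab (add_right_cancel h))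
  have in3 : form (P.vertex a) (P.normal b) < 0 := P.strictly_inside b a hab.symm hba1
  have in4 : form (P.vertex (a + 1)) (P.normal b) < 0 :=
    P.strictly_inside b (a + 1) hab1.symm (fun h => hab (add_right_cancel h).symm)
  have hcone : ∀ (c : ZMod k) {α β : ℝ}, 0 ≤ α → 0 ≤ β → ∀ i,
      form (α • P.vertex c + β • P.vertex (c + 1)) (P.normal i) ≤ 0 := by
    intro c α β hα hβ i
    rw [form_add_left, form_smul_left, form_smul_left]
    have := mul_nonneg hα (neg_nonneg.2 (P.form_vertex_normal_nonpos i c))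
    have := mul_nonneg hβ (neg_nonneg.2 (P.form_vertex_normal_nonpos i (c + 1)))
    linarith
  set g := form (P.normal a) (P.normal b) with hg
  have hun := P.normal_unit a
  have hun' := P.normal_unit b
  have hga : form (P.normal b) (P.normal a) = g := form_comm _ _
  have hg0 : g < 0 := by
    obtain ⟨α, β, hα, hβ, h⟩ := hP.exists_projection_eq hk b
      (fun i => P.form_vertex_normal_nonpos i a)
    have h1 := congrArg (fun z => form z (P.normal a)) h
    simp only [form_sub_left, form_add_left, form_smul_left, P.normal_left a, hga] at h1
    have hne : α ≠ 0 ∨ β ≠ 0 := by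
      by_contra! hne
      rw [hne.1, hne.2, zero_smul, zero_smul, add_zero] at h
      have h2 := congrArg (fun z => form (P.vertex a) z) h
      simp only [form_sub_right, form_smul_right, form_zero_right, (P.vertex_mem a).1] at h2
      nlinarith [sq_nonneg (form (P.vertex a) (P.normal b))]
    have h3 : α * form (P.vertex b) (P.normal a) +
        β * form (P.vertex (b + 1)) (P.normal a) < 0 := by
      rcases hne with hne | hne
      · have := mul_neg_of_pos_of_neg (hα.lt_of_ne' hne) in1
        have := mul_nonneg hβ (neg_nonneg.2 in2.le)
        linarith
      · have := mul_neg_of_pos_of_neg (hβ.lt_of_ne' hne) in2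
        have := mul_nonneg hα (neg_nonneg.2 in1.le)
        linarith
    nlinarith
  by_contra! hg1
  have hgsq : g ^ 2 ≤ 1 := by nlinarith
  -- In terms of `ψ = ⟨x, normal b⟩`, a double projection multiplies `ψ` by `g ^ 2 ≤ 1` and
  -- increases `-⟨x, x⟩` by at least `ψ ^ 2`.
  have iter : ∀ N : ℕ, ∃ α β : ℝ, 0 ≤ α ∧ 0 ≤ β ∧
      form (α • P.vertex a + β • P.vertex (a + 1)) (P.normal b) ≠ 0 ∧
      N * form (α • P.vertex a + β • P.vertex (a + 1)) (P.normal b) ^ 2 ≤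
        -form (α • P.vertex a + β • P.vertex (a + 1)) (α • P.vertex a + β • P.vertex (a + 1)) := by
    intro N
    induction N with
    | zero =>
      refine ⟨1, 0, zero_le_one, le_rfl, ?_, ?_⟩
      · simpa using in3.ne
      · simp [(P.vertex_mem a).1]
    | succ N ih =>
      obtain ⟨α, β, hα, hβ, hne, hN⟩ := ih
      have hxa : form (α • P.vertex a + β • P.vertex (a + 1)) (P.normal a) = 0 := by
        rw [form_add_left, form_smul_left, form_smul_left, P.normal_left, P.normal_right]; ring
      have hxi := hcone a hα hβ
      set x := α • P.vertex a + β • P.vertex (a + 1)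
      obtain ⟨α₁, β₁, hα₁, hβ₁, h₁⟩ := hP.exists_projection_eq hk b hxi
      have hyi := hcone b hα₁ hβ₁
      rw [← h₁] at hyi
      obtain ⟨α₂, β₂, hα₂, hβ₂, h₂⟩ := hP.exists_projection_eq hk a hyi
      refine ⟨α₂, β₂, hα₂, hβ₂, ?_⟩
      rw [← h₂]
      simp only [form_sub_left, form_sub_right, form_smul_left, form_smul_right, hxa, hun, hun',
        hga, form_comm _ x, ← hg]
      rw [show form x (P.normal b) - form x (P.normal b) * 1 -
        (0 - form x (P.normal b) * g) * g = form x (P.normal b) * g ^ 2 by ring]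
      refine ⟨mul_ne_zero hne (pow_ne_zero 2 hg0.ne), ?_⟩
      set ψ := form x (P.normal b)
      push_cast
      have h3 : (ψ * g ^ 2) ^ 2 ≤ ψ ^ 2 := by
        rw [mul_pow]
        have : (g ^ 2) ^ 2 ≤ 1 := pow_le_one₀ (sq_nonneg g) hgsq
        nlinarith [sq_nonneg ψ]
      have h4 : ((N : ℝ) + 1) * (ψ * g ^ 2) ^ 2 ≤ (N + 1) * ψ ^ 2 :=
        mul_le_mul_of_nonneg_left h3 (by positivity)
      have h5 : 0 ≤ ψ ^ 2 * g ^ 2 := by positivity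
      nlinarith
  set h := -form (P.vertex a) (P.vertex (a + 1)) with hh
  have hh0 : 0 < h := by
    have := (P.isFuture_vertex a).form_neg (P.isFuture_vertex (a + 1))
    linarith
  set δ := min (-form (P.vertex a) (P.normal b)) (-form (P.vertex (a + 1)) (P.normal b)) with hδ
  have hδ0 : 0 < δ := lt_min (by linarith) (by linarith)
  have hδ1 : δ ≤ -form (P.vertex a) (P.normal b) := min_le_left _ _
  have hδ2 : δ ≤ -form (P.vertex (a + 1)) (P.normal b) := min_le_right _ _
  obtain ⟨N, hN⟩ := exists_nat_gt ((1 + h) / δ ^ 2)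
  rw [div_lt_iff₀ (by positivity)] at hN
  obtain ⟨α, β, hα, hβ, hne, hle⟩ := iter N
  simp only [form_add_left, form_add_right, form_smul_left, form_smul_right, (P.vertex_mem _).1,
    form_comm (P.vertex (a + 1)) (P.vertex a)] at hne hle
  rw [show form (P.vertex a) (P.vertex (a + 1)) = -h by linarith] at hle
  set ψ := α * form (P.vertex a) (P.normal b) + β * form (P.vertex (a + 1)) (P.normal b)
  have h1 : δ * (α + β) ≤ -ψ := by
    have := mul_le_mul_of_nonneg_left hδ1 hα
    have := mul_le_mul_of_nonneg_left hδ2 hβ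
    simp only [ψ]
    linarith
  have hs : 0 < α + β := by
    by_contra! hs
    have e1 : α = 0 := by linarith
    have e2 : β = 0 := by linarith
    simp [ψ, e1, e2] at hne
  have h2 : (δ * (α + β)) ^ 2 ≤ ψ ^ 2 := by
    rw [← neg_sq ψ]
    exact pow_le_pow_left₀ (by positivity) h1 2
  have h3 : (N : ℝ) * (δ * (α + β)) ^ 2 ≤ N * ψ ^ 2 :=
    mul_le_mul_of_nonneg_left h2 (Nat.cast_nonneg N)
  have h4 : (1 + h) * (α + β) ^ 2 < N * δ ^ 2 * (α + β) ^ 2 :=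
    mul_lt_mul_of_pos_right hN (by positivity)
  have h5 : 0 ≤ α * β := mul_nonneg hα hβ
  have h6 : 0 ≤ h * (α ^ 2 + β ^ 2) := by positivity
  nlinarith

theorem IsRightAngled.exists_proper_pair (hP : P.IsRightAngled) (hk : 6 ≤ k) (heven : Even k) :
    ∃ ρ ρ' : P.reflectionGroup →* O 3,
      IsFaithfulDiscrete ρ ∧ IsFaithfulDiscrete ρ' ∧ ActsProperlyDiscontinuously ρ ρ' := by
  have : NeZero k := ⟨by omega⟩
  have h1 : (1 : ZMod k) ≠ 0 := by simpa using natCast_ne_zero (k := k) one_pos (by omega)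
  have h2 : (2 : ZMod k) ≠ 0 := by simpa using natCast_ne_zero (k := k) two_pos (by omega)
  have h3 : (3 : ZMod k) ≠ 0 := by
    simpa using natCast_ne_zero (k := k) (a := 3) (by omega) (by omega)
  have hadj : ∀ a b, b = a + 1 → form (P.normal a) (P.normal b) = 0 := fun a b h => h ▸ hP a
  have hdich : ∀ a b, a ≠ b →
      form (P.normal a) (P.normal b) = 0 ∧ (b = a + 1 ∨ a = b + 1) ∨
        form (P.normal a) (P.normal b) < -1 := by
    intro a b hab
    by_cases hb : b = a + 1
    · exact Or.inl ⟨hadj a b hb, Or.inl hb⟩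
    by_cases ha : a = b + 1
    · exact Or.inl ⟨by rw [form_comm]; exact hadj b a ha, Or.inr ha⟩
    · exact Or.inr (hP.form_normal_lt hk (Ne.symm hab) hb ha)
  let col : ZMod k → Fin (1 + 1) := ZMod.castHom heven.two_dvd (ZMod 2)
  have hcol : ∀ a b : ZMod k, b = a + 1 → col a ≠ col b := by
    rintro a b rfl h
    have h : ZMod.castHom heven.two_dvd (ZMod 2) a =
        ZMod.castHom heven.two_dvd (ZMod 2) (a + 1) := h
    rw [map_add, map_one, left_eq_add] at h
    exact one_ne_zero h
  refine RightAngledReflection.exists_proper_pair (n := 2) (m := 1) (u := P.normal) P.normal_unit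
    (fun a b hab => (hdich a b hab).imp And.left id)
    (x₀ := P.vertex 0 + P.vertex 2) (col := col) ?_ (fun i => ?_) (fun a b hab => ?_)
  · have := (P.isFuture_vertex 0).smul_add_smul (P.isFuture_vertex 2) zero_le_one zero_le_one
      (by norm_num)
    simpa using this
  · -- No side contains both vertices `0` and `2`.
    rw [form_add_left]
    have e0 := P.form_vertex_normal_nonpos i 0
    have e2 := P.form_vertex_normal_nonpos i 2
    by_cases hi : (0 : ZMod k) = i ∨ (0 : ZMod k) = i + 1
    · have : form (P.vertex 2) (P.normal i) < 0 := by
        apply P.strictly_inside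
        · rintro rfl
          rcases hi with hi | hi
          · exact h2 hi.symm
          · apply h3; linear_combination -hi
        · intro h
          rcases hi with hi | hi
          · apply h1; linear_combination h - hi
          · apply h2; linear_combination h - hi
      linarith
    · push Not at hi
      have := P.strictly_inside i 0 hi.1 hi.2
      linarith
  · by_cases h : a = b
    · subst h
      rw [P.normal_unit] at hab
      exact absurd hab one_ne_zero
    rcases hdich a b h with ⟨-, h' | h'⟩ | h'
    · exact hcol a b h'
    · exact (hcol b a h').symm
    · linarith

end ConvexPolygon

/-! ### The vertices of the 600-cell -/

section Icosians

open Real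

/-- The vector with coordinates `P i + Q i φ`. It is used for `φ` the golden ratio and for its
conjugate. -/
def goldenVec (φ : ℝ) (P Q : Fin 4 → ℤ) (i : Fin 4) : ℝ := P i + Q i * φ

/-- The rational part of the product of two vectors with coordinates in `ℤ[φ]`. -/
def dotRat (P Q P' Q' : Fin 4 → ℤ) : ℤ := ∑ i, (P i * P' i + Q i * Q' i)

/-- The coefficient of `φ` in the product of two vectors with coordinates in `ℤ[φ]`. -/
def dotIrr (P Q P' Q' : Fin 4 → ℤ) : ℤ := ∑ i, (P i * Q' i + Q i * P' i + Q i * Q' i)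

theorem goldenVec_dotProduct {φ : ℝ} (hφ : φ ^ 2 = φ + 1) (P Q P' Q' : Fin 4 → ℤ) :
    goldenVec φ P Q ⬝ᵥ goldenVec φ P' Q' = dotRat P Q P' Q' + dotIrr P Q P' Q' * φ := by
  simp only [dotProduct, goldenVec, dotRat, dotIrr, Int.cast_sum, Finset.sum_mul,
    ← Finset.sum_add_distrib]
  refine Finset.sum_congr rfl fun i _ => ?_
  push_cast
  linear_combination (Q i * Q' i : ℝ) * hφ

/-- Twice `cellRow` is `cellRat + cellIrr * φ`. -/
def cellRat : Fin 3 → Fin 4 → ℤ := ![![0, 0, 0, 2], ![1, 1, 1, 1], ![0, -1, 1, 0]]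

/-- Twice `cellRow` is `cellRat + cellIrr * φ`. -/
def cellIrr : Fin 3 → Fin 4 → ℤ := ![![0, 0, 0, 0], ![0, 0, 0, 0], ![0, 1, 0, 1]]

theorem two_mul_cellRow (a : Fin 3) (i : Fin 4) :
    2 * cellRow a i = cellRat a i + cellIrr a i * goldenRatio := by
  have h : goldenRatio⁻¹ = goldenRatio - 1 :=
    inv_eq_of_mul_eq_one_right (by linear_combination goldenRatio_sq)
  fin_cases a <;> fin_cases i <;> simp [cellRow, cellRat, cellIrr, h] <;> ring

/-- The rational part of twice the element of `cellNormals` with the given data. -/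
def normalRat (a : Fin 3) (ε : Fin 4 → ℤˣ) (σ : Equiv.Perm (Fin 4)) (i : Fin 4) : ℤ :=
  ε i * cellRat a (σ i)

/-- The coefficient of `φ` of twice the element of `cellNormals` with the given data. -/
def normalIrr (a : Fin 3) (ε : Fin 4 → ℤˣ) (σ : Equiv.Perm (Fin 4)) (i : Fin 4) : ℤ :=
  ε i * cellIrr a (σ i)

theorem exists_of_mem_cellNormals {w : Fin 4 → ℝ} (hw : w ∈ cellNormals) :
    ∃ a ε, ∃ σ : Equiv.Perm (Fin 4), σ.sign = 1 ∧
      (2 : ℝ) • w = goldenVec goldenRatio (normalRat a ε σ) (normalIrr a ε σ) := by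
  obtain ⟨a, ε, σ, hσ, h⟩ := hw
  refine ⟨a, ε, σ, Equiv.Perm.mem_alternatingGroup.1 hσ, ?_⟩
  ext i
  rw [Pi.smul_apply, smul_eq_mul, h i, goldenVec, normalRat, normalIrr]
  push_cast
  linear_combination ((ε i : ℤ) : ℝ) * two_mul_cellRow a (σ i)

theorem dotRat_normal_self (a ε σ) :
    dotRat (normalRat a ε σ) (normalIrr a ε σ) (normalRat a ε σ) (normalIrr a ε σ) = 4 := by
  have h : ∀ i, normalRat a ε σ i * normalRat a ε σ i + normalIrr a ε σ i * normalIrr a ε σ i =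
      cellRat a (σ i) * cellRat a (σ i) + cellIrr a (σ i) * cellIrr a (σ i) := by
    intro i
    rcases Int.units_eq_one_or (ε i) with h | h <;> simp [normalRat, normalIrr, h]
  rw [dotRat, Finset.sum_congr rfl fun i _ => h i,
    Equiv.sum_comp σ fun i => cellRat a i * cellRat a i + cellIrr a i * cellIrr a i]
  clear h
  revert a
  decide

theorem dotIrr_normal_self (a ε σ) :
    dotIrr (normalRat a ε σ) (normalIrr a ε σ) (normalRat a ε σ) (normalIrr a ε σ) = 0 := by
  have h : ∀ i, normalRat a ε σ i * normalIrr a ε σ i + normalIrr a ε σ i * normalRat a ε σ i +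
      normalIrr a ε σ i * normalIrr a ε σ i =
      cellRat a (σ i) * cellIrr a (σ i) + cellIrr a (σ i) * cellRat a (σ i) +
        cellIrr a (σ i) * cellIrr a (σ i) := by
    intro i
    rcases Int.units_eq_one_or (ε i) with h | h <;> simp [normalRat, normalIrr, h]
  rw [dotIrr, Finset.sum_congr rfl fun i _ => h i,
    Equiv.sum_comp σ fun i => cellRat a i * cellIrr a i + cellIrr a i * cellRat a i +
      cellIrr a i * cellIrr a i]
  clear h
  revert a
  decide

/-- Modulo `2`, the rows and their even permutations span a self-orthogonal code of length `4` over
the field with four elements `ℤ[φ] / 2`. -/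
theorem even_cell_dot : ∀ a a' : Fin 3, ∀ τ : Equiv.Perm (Fin 4), τ.sign = 1 →
    Even (∑ i, (cellRat a (τ i) * cellRat a' i + cellIrr a (τ i) * cellIrr a' i)) ∧
    Even (∑ i, (cellRat a (τ i) * cellIrr a' i + cellIrr a (τ i) * cellRat a' i +
      cellIrr a (τ i) * cellIrr a' i)) := by
  decide +kernel

/-- Quaternion multiples `q, qi, qj, qk` of a quaternion with coordinates `q`. -/
def quatFrame {R : Type*} [Neg R] (q : Fin 4 → R) : Fin 4 → Fin 4 → R :=
  ![![q 0, q 1, q 2, q 3], ![-q 1, q 0, q 3, -q 2], ![-q 2, -q 3, q 0, q 1],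
    ![-q 3, q 2, -q 1, q 0]]

/-- Twice representatives of the cosets of the binary tetrahedral group in the binary icosahedral
group, rational part. -/
def cosetRat : Fin 5 → Fin 4 → ℤ :=
  ![![2, 0, 0, 0], ![0, -1, 1, 0], ![0, 0, -1, 1], ![0, 1, 0, -1], ![-1, 1, 0, 0]]

/-- Twice representatives of the cosets of the binary tetrahedral group in the binary icosahedral
group, coefficient of `φ`. -/
def cosetIrr : Fin 5 → Fin 4 → ℤ :=
  ![![0, 0, 0, 0], ![0, 1, 0, 1], ![0, 1, 1, 0], ![0, 0, 1, 1], ![1, 0, 0, 1]]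

theorem exists_coset : ∀ a ε, ∀ σ : Equiv.Perm (Fin 4), σ.sign = 1 → ∃ j, ∀ e,
    dotIrr (normalRat a ε σ) (normalIrr a ε σ) (quatFrame (cosetRat j) e)
      (quatFrame (cosetIrr j) e) = 0 := by
  decide +kernel

theorem dotProduct_self_of_mem_cellNormals {w : Fin 4 → ℝ} (hw : w ∈ cellNormals) : w ⬝ᵥ w = 1 := by
  obtain ⟨a, ε, σ, hσ, h⟩ := exists_of_mem_cellNormals hw
  have h2 := goldenVec_dotProduct goldenRatio_sq (normalRat a ε σ) (normalIrr a ε σ)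
    (normalRat a ε σ) (normalIrr a ε σ)
  rw [← h, dotRat_normal_self, dotIrr_normal_self, smul_dotProduct, dotProduct_smul] at h2
  simp only [smul_eq_mul] at h2
  push_cast at h2
  linarith

theorem even_dot_normal (a ε) {σ : Equiv.Perm (Fin 4)} (hσ : σ.sign = 1) (a' ε')
    {σ' : Equiv.Perm (Fin 4)} (hσ' : σ'.sign = 1) :
    Even (dotRat (normalRat a ε σ) (normalIrr a ε σ) (normalRat a' ε' σ') (normalIrr a' ε' σ')) ∧
    Even (dotIrr (normalRat a ε σ) (normalIrr a ε σ) (normalRat a' ε' σ')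
      (normalIrr a' ε' σ')) := by
  have hτ : (σ * σ'⁻¹).sign = 1 := by simp [hσ, hσ']
  have hunit : ∀ (u : ℤˣ), (((u : ℤ) : ℤ) : ZMod 2) = 1 := by
    intro u
    rcases Int.units_eq_one_or u with h | h <;> simp [h]
  obtain ⟨h1, h2⟩ := even_cell_dot a a' (σ * σ'⁻¹) hτ
  rw [← Equiv.sum_comp σ'] at h1 h2
  rw [← ZMod.intCast_eq_zero_iff_even] at h1 h2 ⊢
  rw [← ZMod.intCast_eq_zero_iff_even]
  constructor
  · rw [← h1, dotRat]
    push_cast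
    refine Finset.sum_congr rfl fun i _ => ?_
    simp [normalRat, normalIrr, hunit]
  · rw [← h2, dotIrr]
    push_cast
    refine Finset.sum_congr rfl fun i _ => ?_
    simp [normalRat, normalIrr, hunit]

theorem abs_dotProduct_le_four {x y : Fin 4 → ℝ} (hx : x ⬝ᵥ x = 4) (hy : y ⬝ᵥ y = 4) :
    |x ⬝ᵥ y| ≤ 4 := by
  have h1 : 0 ≤ (x - y) ⬝ᵥ (x - y) := Finset.sum_nonneg fun i _ => mul_self_nonneg _
  have h2 : 0 ≤ (x + y) ⬝ᵥ (x + y) := Finset.sum_nonneg fun i _ => mul_self_nonneg _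
  simp only [sub_dotProduct, dotProduct_sub, add_dotProduct, dotProduct_add,
    dotProduct_comm y x] at h1 h2
  rw [abs_le]
  constructor <;> linarith

/-- Two distinct elements of `cellNormals` have product `φ / 2` or at most `1 / 2`: twice the
product is an element of `ℤ[φ]` which, like its conjugate, has absolute value at most `2`. -/
theorem dotProduct_cellNormals {w w' : Fin 4 → ℝ} (hw : w ∈ cellNormals) (hw' : w' ∈ cellNormals)
    (hne : w ≠ w') : w ⬝ᵥ w' = goldenRatio / 2 ∨ w ⬝ᵥ w' ≤ 1 / 2 := by
  have hlt : w ⬝ᵥ w' < 1 := by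
    have h1 : 0 ≤ (w - w') ⬝ᵥ (w - w') := Finset.sum_nonneg fun i _ => mul_self_nonneg _
    have h2 : (w - w') ⬝ᵥ (w - w') ≠ 0 := by
      rw [Ne, dotProduct_self_eq_zero, sub_eq_zero]
      exact hne
    have h3 := h1.lt_of_ne' h2
    simp only [sub_dotProduct, dotProduct_sub, dotProduct_comm w' w,
      dotProduct_self_of_mem_cellNormals hw, dotProduct_self_of_mem_cellNormals hw'] at h3
    linarith
  obtain ⟨a, ε, σ, hσ, h⟩ := exists_of_mem_cellNormals hw
  obtain ⟨a', ε', σ', hσ', h'⟩ := exists_of_mem_cellNormals hw'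
  have hself : ∀ a ε σ, goldenVec goldenConj (normalRat a ε σ) (normalIrr a ε σ) ⬝ᵥ
      goldenVec goldenConj (normalRat a ε σ) (normalIrr a ε σ) = 4 := by
    intro a ε σ
    rw [goldenVec_dotProduct goldenConj_sq, dotRat_normal_self, dotIrr_normal_self]
    norm_num
  have hconj := abs_le.1 <| abs_dotProduct_le_four (hself a ε σ) (hself a' ε' σ')
  have hself' : ∀ a ε σ, goldenVec goldenRatio (normalRat a ε σ) (normalIrr a ε σ) ⬝ᵥ
      goldenVec goldenRatio (normalRat a ε σ) (normalIrr a ε σ) = 4 := by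
    intro a ε σ
    rw [goldenVec_dotProduct goldenRatio_sq, dotRat_normal_self, dotIrr_normal_self]
    norm_num
  have hgold := abs_le.1 <| abs_dotProduct_le_four (hself' a ε σ) (hself' a' ε' σ')
  obtain ⟨⟨m, hm⟩, ⟨n, hn⟩⟩ := even_dot_normal a ε hσ a' ε' hσ'
  have hval := goldenVec_dotProduct goldenRatio_sq (normalRat a ε σ) (normalIrr a ε σ)
    (normalRat a' ε' σ') (normalIrr a' ε' σ')
  rw [← h, ← h', smul_dotProduct, dotProduct_smul, smul_eq_mul, smul_eq_mul] at hval
  rw [goldenVec_dotProduct goldenConj_sq] at hconj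
  rw [goldenVec_dotProduct goldenRatio_sq] at hgold
  rw [hm, hn] at hval hconj hgold
  push_cast at hval hconj hgold
  have e1 := goldenRatio_sq
  have e2 : (3 / 2 : ℝ) < goldenRatio := by
    nlinarith [goldenRatio_pos]
  have e3 : goldenRatio < 2 := goldenRatio_lt_two
  have e4 : goldenConj = 1 - goldenRatio := by linarith [goldenRatio_add_goldenConj]
  rw [e4] at hconj
  have hn1 : n < 2 := by
    by_contra! hn
    have : (2 : ℝ) ≤ n := by exact_mod_cast hn
    nlinarith
  have hn2 : -2 < n := by
    by_contra! hn
    have : (n : ℝ) ≤ -2 := by exact_mod_cast hn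
    nlinarith
  have hn3 : n = -1 ∨ n = 0 ∨ n = 1 := by omega
  rcases hn3 with rfl | rfl | rfl
  · right
    have : m < 2 := by
      by_contra! hm
      have : (2 : ℝ) ≤ m := by exact_mod_cast hm
      push_cast at hconj
      nlinarith
    have : (m : ℝ) ≤ 1 := by exact_mod_cast Int.lt_add_one_iff.1 this
    push_cast at hval
    linarith
  · right
    have : m < 2 := by
      by_contra! hm
      have : (2 : ℝ) ≤ m := by exact_mod_cast hm
      push_cast at hval
      linarith
    have : (m : ℝ) ≤ 1 := by exact_mod_cast Int.lt_add_one_iff.1 this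
    push_cast at hval
    linarith
  · have h1 : m < 1 := by
      by_contra! hm
      have : (1 : ℝ) ≤ m := by exact_mod_cast hm
      push_cast at hval
      linarith
    rcases (Int.lt_add_one_iff.1 h1 : m ≤ 0).eq_or_lt with rfl | h2
    · left
      push_cast at hval
      linarith
    · right
      have : (m : ℝ) ≤ -1 := by exact_mod_cast Int.le_sub_one_of_lt h2
      push_cast at hval
      linarith

/-- The identity expressing that right multiplications by `1, i, j, k` form an orthogonal frame. -/
theorem sum_quatFrame_dotProduct (q x y : Fin 4 → ℝ) :
    ∑ e, (x ⬝ᵥ quatFrame q e) * (y ⬝ᵥ quatFrame q e) = (q ⬝ᵥ q) * (x ⬝ᵥ y) := by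
  simp [quatFrame, dotProduct, Fin.sum_univ_four]
  ring

theorem quatFrame_goldenVec (φ : ℝ) (P Q : Fin 4 → ℤ) (e : Fin 4) :
    quatFrame (goldenVec φ P Q) e = goldenVec φ (quatFrame P e) (quatFrame Q e) := by
  ext i
  fin_cases e <;> fin_cases i <;> simp [quatFrame, goldenVec] <;> ring

/-- Every element of `cellNormals` has rational coordinates in one of the five frames given by the
cosets of the binary tetrahedral group. -/
theorem exists_rational_frame (w : cellNormals) : ∃ j, ∀ e, ∃ n : ℤ, ((2 : ℝ) • (w : Fin 4 → ℝ)) ⬝ᵥ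
    quatFrame (goldenVec goldenRatio (cosetRat j) (cosetIrr j)) e = n := by
  obtain ⟨a, ε, σ, hσ, h⟩ := exists_of_mem_cellNormals w.2
  obtain ⟨j, hj⟩ := exists_coset a ε σ hσ
  refine ⟨j, fun e => ⟨dotRat (normalRat a ε σ) (normalIrr a ε σ) (quatFrame (cosetRat j) e)
    (quatFrame (cosetIrr j) e), ?_⟩⟩
  rw [quatFrame_goldenVec, h, goldenVec_dotProduct goldenRatio_sq, hj e, Int.cast_zero, zero_mul,
    add_zero]

/-- The coset of the binary tetrahedral group to which an element of `cellNormals`, seen as a unit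
quaternion, belongs. -/
def cellColor (w : cellNormals) : Fin 5 := (exists_rational_frame w).choose

theorem cellColor_spec (w : cellNormals) (e : Fin 4) : ∃ n : ℤ,
    ((2 : ℝ) • (w : Fin 4 → ℝ)) ⬝ᵥ quatFrame (goldenVec goldenRatio (cosetRat (cellColor w))
      (cosetIrr (cellColor w))) e = n :=
  (exists_rational_frame w).choose_spec e

/-- Elements of the same coset of the binary tetrahedral group have rational products. -/
theorem cellColor_ne {w w' : cellNormals} (h : (w : Fin 4 → ℝ) ⬝ᵥ w' = goldenRatio / 2) :
    cellColor w ≠ cellColor w' := by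
  intro hc
  choose m hm using cellColor_spec w
  choose n hn using cellColor_spec w'
  rw [← hc] at hn
  set q := goldenVec goldenRatio (cosetRat (cellColor w)) (cosetIrr (cellColor w)) with hq
  have hqq : q ⬝ᵥ q = 4 := by
    rw [hq, goldenVec_dotProduct goldenRatio_sq]
    have : ∀ j, dotRat (cosetRat j) (cosetIrr j) (cosetRat j) (cosetIrr j) = 4 ∧
        dotIrr (cosetRat j) (cosetIrr j) (cosetRat j) (cosetIrr j) = 0 := by decide
    rw [(this _).1, (this _).2]
    norm_num
  have key := sum_quatFrame_dotProduct q ((2 : ℝ) • (w : Fin 4 → ℝ)) ((2 : ℝ) • (w' : Fin 4 → ℝ))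
  rw [hqq, smul_dotProduct, dotProduct_smul, h] at key
  simp only [hm, hn, smul_eq_mul] at key
  have hirr := goldenRatio_irrational
  apply hirr.ne_rat ((∑ e, m e * n e : ℤ) / 8 : ℚ)
  push_cast
  linarith

theorem finite_cellNormals : cellNormals.Finite := by
  refine (Set.finite_range fun d : Fin 3 × (Fin 4 → ℤˣ) × Equiv.Perm (Fin 4) => fun i =>
    ((d.2.1 i : ℤ) : ℝ) * cellRow d.1 (d.2.2 i)).subset ?_
  rintro w ⟨a, ε, σ, -, h⟩
  exact ⟨(a, ε, σ), funext fun i => (h i).symm⟩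

theorem exists_adjacent_cellNormals : ∃ w w' : cellNormals,
    (w : Fin 4 → ℝ) ⬝ᵥ w' = goldenRatio / 2 := by
  refine ⟨⟨cellRow 0, 0, 1, 1, one_mem _, by simp⟩, ⟨cellRow 2, 2, 1, 1, one_mem _, by simp⟩, ?_⟩
  simp [cellRow, dotProduct, Fin.sum_univ_four]

end Icosians

/-! ### Right-angled 120-cells -/

namespace Regular120Cell

open Real

variable {P : Regular120Cell}

theorem form_normal (w w' : cellNormals) :
    form (P.normal w) (P.normal w') = (w : Fin 4 → ℝ) ⬝ᵥ w' - P.r ^ 2 := by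
  rw [normal, normal, form_act, form_eq_dotProduct]
  simp [pow_two]

/-- The inradius of a right-angled 120-cell in the Klein model: the radius for which the
hyperplanes of two adjacent faces, which have Euclidean angle `4π/5`, become orthogonal. -/
theorem IsRightAngled.sq_r (hP : P.IsRightAngled) : P.r ^ 2 = goldenRatio / 2 := by
  obtain ⟨w, w', hww'⟩ := exists_adjacent_cellNormals
  have hφ := goldenRatio_pos
  have hφ2 := goldenRatio_lt_two
  have hne : w ≠ w' := by
    rintro rfl
    rw [dotProduct_self_of_mem_cellNormals w.2] at hww'
    linarith
  -- The midpoint `y` of the centers of the two faces, pushed out to their intersection.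
  set μ := P.r / (1 + goldenRatio / 2) with hμ
  have hμ0 : 0 < μ := div_pos P.r_pos (by linarith)
  have hμr : μ * (1 + goldenRatio / 2) = P.r := by
    rw [hμ]; field_simp
  set y : Fin 4 → ℝ := μ • ((w : Fin 4 → ℝ) + w') with hy
  have hle : ∀ z ∈ cellNormals, ∀ z' ∈ cellNormals, z ≠ z' → z ⬝ᵥ z' ≤ goldenRatio / 2 := by
    intro z hz z' hz' h
    rcases dotProduct_cellNormals hz hz' h with h | h
    · exact h.le
    · linarith [one_lt_goldenRatio]
  have hwy : (w : Fin 4 → ℝ) ⬝ᵥ y = P.r := by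
    rw [hy, dotProduct_smul, dotProduct_add, dotProduct_self_of_mem_cellNormals w.2, hww',
      smul_eq_mul, hμr]
  have hw'y : (w' : Fin 4 → ℝ) ⬝ᵥ y = P.r := by
    rw [hy, dotProduct_smul, dotProduct_add, dotProduct_self_of_mem_cellNormals w'.2,
      dotProduct_comm, hww', smul_eq_mul, add_comm, hμr]
  have hzy : ∀ z ∈ cellNormals, z ⬝ᵥ y ≤ P.r := by
    intro z hz
    by_cases h : z = w
    · rw [h, hwy]
    by_cases h' : z = w'
    · rw [h', hw'y]
    rw [hy, dotProduct_smul, dotProduct_add, smul_eq_mul, ← hμr]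
    apply mul_le_mul_of_nonneg_left _ hμ0.le
    linarith [hle z hz w w.2 h, hle z hz w' w'.2 h']
  have hyy := P.subset_ball y hzy
  set s := (√(1 - y ⬝ᵥ y))⁻¹ with hs
  have hs0 : 0 < s := inv_pos.2 (Real.sqrt_pos.2 (by linarith))
  have hs2 : s ^ 2 * (1 - y ⬝ᵥ y) = 1 := by
    rw [hs, inv_pow, Real.sq_sqrt (by linarith)]
    exact inv_mul_cancel₀ (by linarith)
  set x : Fin 4 ⊕ Fin 1 → ℝ := Sum.elim (s • y) fun _ => s with hx
  have hxH : x ∈ hyperbolicSpace 4 := by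
    refine ⟨?_, hs0⟩
    rw [form_eq_dotProduct]
    have : (fun i => x (Sum.inl i)) = s • y := rfl
    rw [this, smul_dotProduct, dotProduct_smul]
    simp only [smul_eq_mul, hx, Sum.elim_inr]
    linarith
  have hxn : ∀ z : cellNormals, form (act P.isometry x) (P.normal z) =
      s * ((z : Fin 4 → ℝ) ⬝ᵥ y - P.r) := by
    intro z
    rw [normal, form_act, form_eq_dotProduct]
    have : (fun i => x (Sum.inl i)) = s • y := rfl
    rw [this, smul_dotProduct, dotProduct_comm]
    simp only [smul_eq_mul, hx, Sum.elim_inr, Sum.elim_inl]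
    ring
  have hbody : act P.isometry x ∈ P.body := by
    refine ⟨P.isometry_mem x hxH, fun z => ?_⟩
    rw [hxn]
    exact mul_nonpos_of_nonneg_of_nonpos hs0.le (sub_nonpos.2 (hzy z z.2))
  have h := hP w w' hne ⟨act P.isometry x, ⟨hbody, by rw [hxn, hwy]; ring⟩,
    ⟨hbody, by rw [hxn, hw'y]; ring⟩⟩
  rw [form_normal, hww'] at h
  linarith

theorem IsRightAngled.exists_proper_pair (hP : P.IsRightAngled) :
    ∃ ρ ρ' : P.reflectionGroup →* O 8,
      IsFaithfulDiscrete ρ ∧ IsFaithfulDiscrete ρ' ∧ ActsProperlyDiscontinuously ρ ρ' := by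
  have hfin : Finite cellNormals := finite_cellNormals
  have hr := hP.sq_r
  have hφ2 := goldenRatio_lt_two
  have hφ3 : (3 / 2 : ℝ) < goldenRatio := by nlinarith [goldenRatio_pos, goldenRatio_sq]
  set a := (√(1 - goldenRatio / 2))⁻¹ with ha
  have ha0 : 0 < a := inv_pos.2 (Real.sqrt_pos.2 (by linarith))
  have ha2 : a * a * (1 - goldenRatio / 2) = 1 := by
    rw [ha, ← pow_two, inv_pow, Real.sq_sqrt (by linarith)]
    exact inv_mul_cancel₀ (by linarith)
  have hform : ∀ w w' : cellNormals, form (a • P.normal w) (a • P.normal w') =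
      a * a * ((w : Fin 4 → ℝ) ⬝ᵥ w' - goldenRatio / 2) := by
    intro w w'
    rw [form_smul_left, form_smul_right, form_normal, hr]
    ring
  have hgroup : P.reflectionGroup =
      Subgroup.closure (Set.range fun w => reflection (a • P.normal w)) := by
    simp only [reflection_smul _ ha0.ne']
    rfl
  have ho : origin 4 ∈ hyperbolicSpace 4 := ⟨form_origin_origin, isFuture_origin.2⟩
  have hx₀ := P.isometry_mem _ ho
  have hunit : ∀ w, form (a • P.normal w) (a • P.normal w) = 1 := by
    intro w
    rw [hform, dotProduct_self_of_mem_cellNormals w.2, ha2]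
  rw [hgroup]
  refine RightAngledReflection.exists_proper_pair (n := 4) (m := 4) hunit (fun w w' h => ?_)
    (x₀ := act P.isometry (origin 4)) ⟨by rw [hx₀.1]; norm_num, hx₀.2⟩ (fun w => ?_)
    (col := cellColor) (fun w w' h => ?_)
  · rw [hform]
    rcases dotProduct_cellNormals w.2 w'.2 (fun h' => h (Subtype.ext h')) with h' | h'
    · left
      rw [h', sub_self, mul_zero]
    · right
      have : 0 < a * a := mul_pos ha0 ha0
      nlinarith
  · rw [form_smul_right, normal, form_act, form_origin_left]
    simp only [Sum.elim_inr]
    nlinarith [mul_pos ha0 P.r_pos]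
  · rw [hform] at h
    apply cellColor_ne
    rcases mul_eq_zero.1 h with h | h
    · exact absurd h (mul_pos ha0 ha0).ne'
    · linarith

end Regular120Cell

end RightAngledReflection

end

theorem proposition1p8 :
    (∀ k : ℕ, Even k → 6 ≤ k →
      ∀ P : RightAngledReflection.ConvexPolygon k, P.IsRightAngled →
        ∃ ρ ρ' : P.reflectionGroup →* RightAngledReflection.O 3,
          RightAngledReflection.IsFaithfulDiscrete ρ ∧
          RightAngledReflection.IsFaithfulDiscrete ρ' ∧
          RightAngledReflection.ActsProperlyDiscontinuously ρ ρ') ∧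
    (∀ P : RightAngledReflection.Regular120Cell, P.IsRightAngled →
        ∃ ρ ρ' : P.reflectionGroup →* RightAngledReflection.O 8,
          RightAngledReflection.IsFaithfulDiscrete ρ ∧
          RightAngledReflection.IsFaithfulDiscrete ρ' ∧
          RightAngledReflection.ActsProperlyDiscontinuously ρ ρ') :=
  ⟨fun _ heven hk _ hP => hP.exists_proper_pair hk heven, fun _ hP => hP.exists_proper_pair⟩
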